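/- All Lie algebras are over $\mathbb C$. **Graded Lie algebras.** A graded Lie algebra is a Lie algebra $\mathfrak g=\bigoplus_{i\in\mathbb Z}\mathfrak g_i$ with $\dim\mathfrak g_i<\infty$ and $[\mathfrak g_i,\mathfrak g_j]\subset\mathfrak g_{i+j}$ for all $i,j\in\mathbb Z$, generated by its local part $\mathfrak g_{-1}\oplus\mathfrak g_0\oplus\mathfrak g_1$. It is transitive if, for $i\ge 0$ and $x\in\mathfrak g_i$, $[x,\mathfrak g_{-1}]=0$ implies $x=0$, and, for $i\le 0$ and $x\in\mathfrak g_i$, $[x,\mathfrak g_1]=0$ implies $x=0$. A quadratic graded Lie algebra is a pair $(\mathfrak g,B)$ with $\mathfrak g$ a graded Lie algebra and $B$ a nondegenerate symmetric bilinear form on $\mathfrak g$ which is invariant, i.e. $B([x,y],z)=B(x,[y,z])$, and satisfies $B(\mathfrak g_i,\mathfrak g_j)=0$ if $i\ne -j$. An isomorphism of quadratic graded Lie algebras is an isomorphism of Lie algebras that respects the gradings and the forms. **Fundamental triplets.** A fundamental triplet $(\mathfrak g_0,B_0,(\rho,V))$ consists of a finite-dimensional Lie algebra $\mathfrak g_0$,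 a nondegenerate invariant symmetric bilinear form $B_0$ on $\mathfrak g_0$, and a finite-dimensional representation $(\rho,V)$ of $\mathfrak g_0$; write $U.X=\rho(U)X$ for $U\in\mathfrak g_0$, $X\in V$, and $U.Y$ for the contragredient action on $Y\in V^*$. An isomorphism $(\mathfrak g_0^1,B_0^1,(\rho_1,V_1))\to(\mathfrak g_0^2,B_0^2,(\rho_2,V_2))$ is a pair $(A,\gamma)$ of an isomorphism of Lie algebras $A:\mathfrak g_0^1\to\mathfrak g_0^2$ and a linear isomorphism $\gamma:V_1\to V_2$ with $B_0^2(A(U),A(U'))=B_0^1(U,U')$ and $\rho_2(A(U))\circ\gamma=\gamma\circ\rho_1(U)$ for all $U,U'\in\mathfrak g_0^1$. **The algebra $\mathfrak g_{min}$.** To a fundamental triplet one attaches the local Lie algebra $\Gamma=\Gamma(\mathfrak g_0,B_0,\rho)=V^*\oplus\mathfrak g_0\oplus V$ (degrees $-1,0,1$), with the bracket of $\mathfrak g_0$, $[U,X]=U.X$, $[U,Y]=U.Y$, and $[X,Y]\in\mathfrak g_0$ determined by $B_0([X,Y],U)=Y(U.X)$ for all $U\in\mathfrak g_0$ ($X\in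 V$, $Y\in V^*$). Let $\mathfrak g_{max}(\Gamma)$ be the Lie algebra generated by the vector space $\Gamma$ subject only to the brackets just defined, graded by the degree of Lie monomials in homogeneous elements of $\Gamma$; let $J_{max}$ be the largest graded ideal of $\mathfrak g_{max}(\Gamma)$ with $J_{max}\cap\Gamma=0$, and put $\mathfrak g_{min}(\Gamma)=\mathfrak g_{max}(\Gamma)/J_{max}$ with the induced grading. **Theorem.** Let $\mathcal T$ be the set of isomorphism classes of fundamental triplets $(\mathfrak g_0,B_0,(\rho,V))$ such that $\rho$ is faithful, $V$ is spanned by $\mathfrak g_0.V$ and $V^*$ is spanned by $\mathfrak g_0.V^*$, and let $\mathcal G$ be the set of isomorphism classes of transitive quadratic graded Lie algebras. For every triplet representing a class in $\mathcal T$ there is exactly one invariant symmetric bilinear form $B$ on $\mathfrak g_{min}(\Gamma(\mathfrak g_0,B_0,\rho))$ for which the components of degrees $i$ and $j$ are orthogonal whenever $i\ne -j$, which equals $B_0$ on $\mathfrak g_0$, and for which $B(X,Y)=Y(X)$ for $X\in V$, $Y\in V^*$. With this form, $\mathfrak g_{min}(\Gamma(\mathfrak g_0,B_0,\rho))$ is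 a transitive quadratic graded Lie algebra; its class depends only on the class of the triplet, and the resulting map $$\tau:\mathcal T\to\mathcal G,\qquad \overline{(\mathfrak g_0,B_0,\rho)}\mapsto\overline{(\mathfrak g_{min}(\Gamma(\mathfrak g_0,B_0,\rho)),B)}$$ is a bijection. -/

import Mathlib

universe u

noncomputable section

/-! All Lie algebras are over the complex numbers. -/

/-! ### Graded Lie algebras -/

/-- `gr` makes the Lie algebra `L` into a graded Lie algebra: `L` is the direct sum of the
finite-dimensional subspaces `gr i`, the bracket is compatible with the degrees, and `L` is
generated by its local part. -/
structure IsGradedLieAlgebra {L : Type u} [LieRing L] [LieAlgebra ℂ L]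
    (gr : ℤ → Submodule ℂ L) : Prop where
  isInternal : DirectSum.IsInternal gr
  finiteDimensional : ∀ i, FiniteDimensional ℂ (gr i)
  lie_mem : ∀ i j, ∀ x ∈ gr i, ∀ y ∈ gr j, ⁅x, y⁆ ∈ gr (i + j)
  generated : LieSubalgebra.lieSpan ℂ L
    ((gr (-1) : Set L) ∪ (gr 0 : Set L) ∪ (gr 1 : Set L)) = ⊤

/-- Transitivity in the sense of Kac. -/
structure IsTransitiveGrading {L : Type u} [LieRing L] [LieAlgebra ℂ L]
    (gr : ℤ → Submodule ℂ L) : Prop where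
  nonneg : ∀ i : ℤ, 0 ≤ i → ∀ x ∈ gr i, (∀ y ∈ gr (-1), ⁅x, y⁆ = 0) → x = 0
  nonpos : ∀ i : ℤ, i ≤ 0 → ∀ x ∈ gr i, (∀ y ∈ gr 1, ⁅x, y⁆ = 0) → x = 0

/-- `B` is a symmetric invariant bilinear form. -/
structure IsInvariantForm {L : Type u} [LieRing L] [LieAlgebra ℂ L]
    (B : LinearMap.BilinForm ℂ L) : Prop where
  symm : ∀ x y, B x y = B y x
  invariant : ∀ x y z, B ⁅x, y⁆ z = B x ⁅y, z⁆

/-- `B` vanishes on `gr i × gr j` unless `i = -j`. -/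
def IsGradedForm {L : Type u} [LieRing L] [LieAlgebra ℂ L]
    (gr : ℤ → Submodule ℂ L) (B : LinearMap.BilinForm ℂ L) : Prop :=
  ∀ i j : ℤ, i ≠ -j → ∀ x ∈ gr i, ∀ y ∈ gr j, B x y = 0

/-- `(L, gr, B)` is a transitive quadratic graded Lie algebra. -/
structure IsTransitiveQuadratic {L : Type u} [LieRing L] [LieAlgebra ℂ L]
    (gr : ℤ → Submodule ℂ L) (B : LinearMap.BilinForm ℂ L) : Prop where
  graded : IsGradedLieAlgebra gr
  transitive : IsTransitiveGrading gr
  form : IsInvariantForm B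
  nondegenerate : B.Nondegenerate
  gradedForm : IsGradedForm gr B

/-- A (bundled) transitive quadratic graded Lie algebra. -/
structure TransitiveQuadraticGLA where
  carrier : Type u
  [lieRing : LieRing carrier]
  [lieAlgebra : LieAlgebra ℂ carrier]
  gr : ℤ → Submodule ℂ carrier
  B : LinearMap.BilinForm ℂ carrier
  isTransitiveQuadratic : IsTransitiveQuadratic gr B

attribute [instance] TransitiveQuadraticGLA.lieRing TransitiveQuadraticGLA.lieAlgebra

namespace TransitiveQuadraticGLA

/-- Isomorphism of quadratic graded Lie algebras: a Lie algebra isomorphism which respects the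
gradings and the forms. -/
def Iso (G H : TransitiveQuadraticGLA.{u}) : Prop :=
  ∃ Ψ : G.carrier ≃ₗ⁅ℂ⁆ H.carrier,
    (∀ (n : ℤ) (x : G.carrier), x ∈ G.gr n ↔ Ψ x ∈ H.gr n) ∧
    (∀ x y : G.carrier, H.B (Ψ x) (Ψ y) = G.B x y)

theorem Iso.refl (G : TransitiveQuadraticGLA.{u}) : Iso G G :=
  ⟨LieEquiv.refl, fun _ _ => Iff.rfl, fun _ _ => rfl⟩

theorem Iso.symm {G H : TransitiveQuadraticGLA.{u}} (h : Iso G H) : Iso H G := by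
  obtain ⟨Ψ, h1, h2⟩ := h
  refine ⟨Ψ.symm, fun n x => ?_, fun x y => ?_⟩
  · rw [h1, LieEquiv.apply_symm_apply]
  · rw [← h2, LieEquiv.apply_symm_apply, LieEquiv.apply_symm_apply]

theorem Iso.trans {G H K : TransitiveQuadraticGLA.{u}} (h : Iso G H) (k : Iso H K) :
    Iso G K := by
  obtain ⟨Ψ, h1, h2⟩ := h
  obtain ⟨Φ, k1, k2⟩ := k
  refine ⟨Ψ.trans Φ, fun n x => ?_, fun x y => ?_⟩
  · rw [h1, k1, LieEquiv.trans_apply]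
  · rw [LieEquiv.trans_apply, LieEquiv.trans_apply, k2, h2]

instance setoid : Setoid TransitiveQuadraticGLA.{u} where
  r := Iso
  iseqv := ⟨Iso.refl, Iso.symm, Iso.trans⟩

/-- Isomorphism classes of transitive quadratic graded Lie algebras. -/
def Classes : Type (u + 1) := Quotient (setoid.{u})

/-- The isomorphism class of a transitive quadratic graded Lie algebra. -/
def toClass (G : TransitiveQuadraticGLA.{u}) : Classes.{u} := Quotient.mk setoid G

end TransitiveQuadraticGLA

/-! ### Local Lie algebras -/

/-- A local Lie algebra `neg ⊕ zero ⊕ pos` (degrees `-1, 0, 1`). The brackets that are defined are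
`zero × zero → zero`, `zero × pos → pos`, `zero × neg → neg` and `pos × neg → zero` (the others
follow by anticommutativity). The Jacobi identities that make sense say that `zero` is a Lie
algebra, that `pos` and `neg` are `zero`-modules, and that `pos × neg → zero` is equivariant. -/
structure LocalLieAlgebra where
  neg : Type u
  zero : Type u
  pos : Type u
  [lieRing : LieRing zero]
  [lieAlgebra : LieAlgebra ℂ zero]
  [addCommGroupNeg : AddCommGroup neg]
  [moduleNeg : Module ℂ neg]
  [lieRingModuleNeg : LieRingModule zero neg]
  [lieModuleNeg : LieModule ℂ zero neg]
  [addCommGroupPos : AddCommGroup pos]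
  [modulePos : Module ℂ pos]
  [lieRingModulePos : LieRingModule zero pos]
  [lieModulePos : LieModule ℂ zero pos]
  [finiteNeg : FiniteDimensional ℂ neg]
  [finiteZero : FiniteDimensional ℂ zero]
  [finitePos : FiniteDimensional ℂ pos]
  bracket : pos →ₗ[ℂ] neg →ₗ[ℂ] zero
  jacobi : ∀ (z : zero) (x : pos) (y : neg),
    ⁅z, bracket x y⁆ = bracket ⁅z, x⁆ y + bracket x ⁅z, y⁆

attribute [instance] LocalLieAlgebra.lieRing LocalLieAlgebra.lieAlgebra
  LocalLieAlgebra.addCommGroupNeg LocalLieAlgebra.moduleNeg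
  LocalLieAlgebra.lieRingModuleNeg LocalLieAlgebra.lieModuleNeg
  LocalLieAlgebra.addCommGroupPos LocalLieAlgebra.modulePos
  LocalLieAlgebra.lieRingModulePos LocalLieAlgebra.lieModulePos
  LocalLieAlgebra.finiteNeg LocalLieAlgebra.finiteZero LocalLieAlgebra.finitePos

namespace LocalLieAlgebra

variable (Γ : LocalLieAlgebra.{u})

/-- The vector space underlying a local Lie algebra. -/
abbrev Space : Type u := Γ.neg × Γ.zero × Γ.pos

/-- The relators of the maximal graded Lie algebra, in the free Lie algebra on the set underlying
`Γ`: linearity of the inclusion of `Γ`, and all the brackets that are defined in `Γ`. -/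
inductive IsRelator : FreeLieAlgebra ℂ Γ.Space → Prop
  | add (a b : Γ.Space) : IsRelator
      (FreeLieAlgebra.of ℂ (a + b) - (FreeLieAlgebra.of ℂ a + FreeLieAlgebra.of ℂ b))
  | smul (c : ℂ) (a : Γ.Space) : IsRelator
      (FreeLieAlgebra.of ℂ (c • a) - c • FreeLieAlgebra.of ℂ a)
  | zero_zero (u v : Γ.zero) : IsRelator
      (⁅FreeLieAlgebra.of ℂ ((0, u, 0) : Γ.Space), FreeLieAlgebra.of ℂ ((0, v, 0) : Γ.Space)⁆
        - FreeLieAlgebra.of ℂ ((0, ⁅u, v⁆, 0) : Γ.Space))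
  | zero_pos (u : Γ.zero) (x : Γ.pos) : IsRelator
      (⁅FreeLieAlgebra.of ℂ ((0, u, 0) : Γ.Space), FreeLieAlgebra.of ℂ ((0, 0, x) : Γ.Space)⁆
        - FreeLieAlgebra.of ℂ ((0, 0, ⁅u, x⁆) : Γ.Space))
  | zero_neg (u : Γ.zero) (y : Γ.neg) : IsRelator
      (⁅FreeLieAlgebra.of ℂ ((0, u, 0) : Γ.Space), FreeLieAlgebra.of ℂ ((y, 0, 0) : Γ.Space)⁆
        - FreeLieAlgebra.of ℂ ((⁅u, y⁆, 0, 0) : Γ.Space))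
  | pos_neg (x : Γ.pos) (y : Γ.neg) : IsRelator
      (⁅FreeLieAlgebra.of ℂ ((0, 0, x) : Γ.Space), FreeLieAlgebra.of ℂ ((y, 0, 0) : Γ.Space)⁆
        - FreeLieAlgebra.of ℂ ((0, Γ.bracket x y, 0) : Γ.Space))

/-- The ideal generated by the relators. -/
def relatorIdeal : LieIdeal ℂ (FreeLieAlgebra ℂ Γ.Space) :=
  LieSubmodule.lieSpan ℂ (FreeLieAlgebra ℂ Γ.Space) {a | Γ.IsRelator a}

/-- The maximal graded Lie algebra with local part `Γ`: the Lie algebra generated by `Γ`, subject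
only to the brackets of `Γ`. -/
abbrev Gmax : Type u := FreeLieAlgebra ℂ Γ.Space ⧸ Γ.relatorIdeal

/-- The canonical map from `Γ` to the maximal graded Lie algebra. -/
def toGmax (a : Γ.Space) : Γ.Gmax :=
  LieSubmodule.Quotient.mk' Γ.relatorIdeal (FreeLieAlgebra.of ℂ a)

/-- `Γ.IsMonomial n a`: `a` is a Lie monomial, of total degree `n`, in homogeneous elements
of `Γ`. -/
inductive IsMonomial : ℤ → Γ.Gmax → Prop
  | neg (y : Γ.neg) : IsMonomial (-1) (Γ.toGmax (y, 0, 0))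
  | zero (u : Γ.zero) : IsMonomial 0 (Γ.toGmax (0, u, 0))
  | pos (x : Γ.pos) : IsMonomial 1 (Γ.toGmax (0, 0, x))
  | lie {m n : ℤ} {a b : Γ.Gmax} (ha : IsMonomial m a) (hb : IsMonomial n b) :
      IsMonomial (m + n) ⁅a, b⁆

/-- The grading of the maximal graded Lie algebra. -/
def gmaxGrading (n : ℤ) : Submodule ℂ Γ.Gmax :=
  Submodule.span ℂ {a | Γ.IsMonomial n a}

/-- The local part of the maximal graded Lie algebra. -/
def gmaxLocalPart : Submodule ℂ Γ.Gmax :=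
  Γ.gmaxGrading (-1) ⊔ Γ.gmaxGrading 0 ⊔ Γ.gmaxGrading 1

/-- `J` is a graded ideal which meets the local part trivially. -/
structure IsAdmissibleIdeal (J : LieIdeal ℂ Γ.Gmax) : Prop where
  graded : J.toSubmodule ≤ ⨆ n : ℤ, J.toSubmodule ⊓ Γ.gmaxGrading n
  disjoint : J.toSubmodule ⊓ Γ.gmaxLocalPart = ⊥

/-- The largest graded ideal which meets the local part trivially (the sum of all of them). -/
def Jmax : LieIdeal ℂ Γ.Gmax := sSup {J | Γ.IsAdmissibleIdeal J}

/-- The minimal graded Lie algebra with local part `Γ`. -/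
abbrev Gmin : Type u := Γ.Gmax ⧸ Γ.Jmax

/-- The grading of the minimal graded Lie algebra, induced from the maximal one. -/
def gminGrading (n : ℤ) : Submodule ℂ Γ.Gmin :=
  (Γ.gmaxGrading n).map (LieSubmodule.Quotient.mk' Γ.Jmax : Γ.Gmax →ₗ[ℂ] Γ.Gmin)

/-- The canonical map from `Γ` to the minimal graded Lie algebra. -/
def toGmin (a : Γ.Space) : Γ.Gmin := LieSubmodule.Quotient.mk' Γ.Jmax (Γ.toGmax a)

end LocalLieAlgebra

/-! ### Fundamental triplets -/

/-- A fundamental triplet: a finite-dimensional Lie algebra `g₀` with a nondegenerate symmetric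
invariant bilinear form `B₀`, and a finite-dimensional representation `V` of `g₀`. -/
structure FundamentalTriplet where
  g₀ : Type u
  V : Type u
  [lieRing : LieRing g₀]
  [lieAlgebra : LieAlgebra ℂ g₀]
  [finiteDimensional : FiniteDimensional ℂ g₀]
  [addCommGroupV : AddCommGroup V]
  [moduleV : Module ℂ V]
  [finiteDimensionalV : FiniteDimensional ℂ V]
  [lieRingModule : LieRingModule g₀ V]
  [lieModule : LieModule ℂ g₀ V]
  B₀ : LinearMap.BilinForm ℂ g₀
  form : IsInvariantForm B₀
  nondegenerate : B₀.Nondegenerate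

attribute [instance] FundamentalTriplet.lieRing FundamentalTriplet.lieAlgebra
  FundamentalTriplet.finiteDimensional FundamentalTriplet.addCommGroupV
  FundamentalTriplet.moduleV FundamentalTriplet.finiteDimensionalV
  FundamentalTriplet.lieRingModule FundamentalTriplet.lieModule

namespace FundamentalTriplet

/-- Isomorphism of fundamental triplets. -/
def Iso (S T : FundamentalTriplet.{u}) : Prop :=
  ∃ (A : S.g₀ ≃ₗ⁅ℂ⁆ T.g₀) (γ : S.V ≃ₗ[ℂ] T.V),
    (∀ u v : S.g₀, T.B₀ (A u) (A v) = S.B₀ u v) ∧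
    (∀ (u : S.g₀) (x : S.V), ⁅A u, γ x⁆ = γ ⁅u, x⁆)

theorem Iso.refl (T : FundamentalTriplet.{u}) : Iso T T :=
  ⟨LieEquiv.refl, LinearEquiv.refl ℂ T.V, fun _ _ => rfl, fun _ _ => rfl⟩

theorem Iso.symm {S T : FundamentalTriplet.{u}} (h : Iso S T) : Iso T S := by
  obtain ⟨A, γ, h1, h2⟩ := h
  refine ⟨A.symm, γ.symm, fun u v => ?_, fun u x => ?_⟩
  · rw [← h1, LieEquiv.apply_symm_apply, LieEquiv.apply_symm_apply]
  · apply γ.injective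
    rw [← h2, LieEquiv.apply_symm_apply, LinearEquiv.apply_symm_apply,
      LinearEquiv.apply_symm_apply]

theorem Iso.trans {S T U : FundamentalTriplet.{u}} (h : Iso S T) (k : Iso T U) : Iso S U := by
  obtain ⟨A, γ, h1, h2⟩ := h
  obtain ⟨A', γ', k1, k2⟩ := k
  refine ⟨A.trans A', γ.trans γ', fun u v => ?_, fun u x => ?_⟩
  · rw [LieEquiv.trans_apply, LieEquiv.trans_apply, k1, h1]
  · rw [LieEquiv.trans_apply, LinearEquiv.trans_apply, LinearEquiv.trans_apply, k2, h2]

/-- The representation is faithful, `⟨g₀.V⟩ = V`, and `⟨g₀.V*⟩ = V*` for the contragredient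
representation. -/
structure Admissible (T : FundamentalTriplet.{u}) : Prop where
  faithful : ∀ u : T.g₀, (∀ x : T.V, ⁅u, x⁆ = 0) → u = 0
  span_V : Submodule.span ℂ {w : T.V | ∃ (u : T.g₀) (x : T.V), w = ⁅u, x⁆} = ⊤
  span_dual : Submodule.span ℂ
    {w : Module.Dual ℂ T.V | ∃ (u : T.g₀) (y : Module.Dual ℂ T.V), w = ⁅u, y⁆} = ⊤

instance admissibleSetoid : Setoid {T : FundamentalTriplet.{u} // T.Admissible} where
  r S T := Iso S.1 T.1
  iseqv := ⟨fun T => Iso.refl T.1, Iso.symm, Iso.trans⟩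

/-- Isomorphism classes of the fundamental triplets with `ρ` faithful, `⟨g₀.V⟩ = V` and
`⟨g₀.V*⟩ = V*`. -/
def Classes : Type (u + 1) := Quotient (admissibleSetoid.{u})

/-- The isomorphism class of an admissible fundamental triplet. -/
def toClass (T : FundamentalTriplet.{u}) (hT : T.Admissible) : Classes.{u} :=
  Quotient.mk admissibleSetoid ⟨T, hT⟩

/-- For `x ∈ V` and `y ∈ V*`, the linear form `u ↦ y (u.x)` on `g₀`, bilinearly in `x, y`. -/
def momentForm (T : FundamentalTriplet.{u}) :
    T.V →ₗ[ℂ] Module.Dual ℂ T.V →ₗ[ℂ] Module.Dual ℂ T.g₀ :=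
  LinearMap.mk₂ ℂ
    (fun x y => y.comp ((LieModule.toEnd ℂ T.g₀ T.V : T.g₀ →ₗ[ℂ] Module.End ℂ T.V).flip x))
    (fun x x' y => by ext u; simp)
    (fun c x y => by ext u; simp)
    (fun x y y' => by ext u; simp)
    (fun c x y => by ext u; simp)

/-- The bracket `V × V* → g₀`: `[x, y]` is the element with `B₀ [x, y] u = y (u.x)` for all
`u`. -/
def bracket (T : FundamentalTriplet.{u}) :
    T.V →ₗ[ℂ] Module.Dual ℂ T.V →ₗ[ℂ] T.g₀ :=
  T.momentForm.compr₂ (T.B₀.toDual T.nondegenerate).symm.toLinearMap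

theorem B₀_bracket (T : FundamentalTriplet.{u}) (x : T.V) (y : Module.Dual ℂ T.V) (u : T.g₀) :
    T.B₀ (T.bracket x y) u = y ⁅u, x⁆ := by
  simp [bracket, momentForm]

theorem bracket_jacobi (T : FundamentalTriplet.{u}) (z : T.g₀) (x : T.V)
    (y : Module.Dual ℂ T.V) :
    ⁅z, T.bracket x y⁆ = T.bracket ⁅z, x⁆ y + T.bracket x ⁅z, y⁆ := by
  have key : ∀ u, T.B₀ ⁅z, T.bracket x y⁆ u
      = T.B₀ (T.bracket ⁅z, x⁆ y + T.bracket x ⁅z, y⁆) u := by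
    intro u
    rw [← lie_skew, map_neg, LinearMap.neg_apply, T.form.invariant, map_add,
      LinearMap.add_apply, B₀_bracket, B₀_bracket, B₀_bracket, Module.Dual.lie_apply,
      lie_lie, map_sub]
    ring
  have h2 : T.B₀.toDual T.nondegenerate ⁅z, T.bracket x y⁆
      = T.B₀.toDual T.nondegenerate (T.bracket ⁅z, x⁆ y + T.bracket x ⁅z, y⁆) :=
    LinearMap.ext key
  exact (T.B₀.toDual T.nondegenerate).injective h2

/-- The local Lie algebra `Γ(g₀, B₀, ρ) = V* ⊕ g₀ ⊕ V`. -/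
def toLocal (T : FundamentalTriplet.{u}) : LocalLieAlgebra.{u} where
  neg := Module.Dual ℂ T.V
  zero := T.g₀
  pos := T.V
  bracket := T.bracket
  jacobi := T.bracket_jacobi

/-- The form on `Γ(g₀, B₀, ρ)`: it is `B₀` on `g₀`, the duality pairing between `V` and `V*`,
and zero on the other pairs of components. -/
def localForm (T : FundamentalTriplet.{u}) :
    Module.Dual ℂ T.V × T.g₀ × T.V → Module.Dual ℂ T.V × T.g₀ × T.V → ℂ :=
  fun a b => T.B₀ a.2.1 b.2.1 + a.1 b.2.2 + b.1 a.2.2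

/-- `B` is an extension of the form on `Γ(g₀, B₀, ρ)` to an invariant symmetric bilinear form on
the minimal graded Lie algebra for which `gr i` and `gr j` are orthogonal unless `i = -j`. -/
structure IsExtendedForm (T : FundamentalTriplet.{u})
    (B : LinearMap.BilinForm ℂ T.toLocal.Gmin) : Prop where
  form : IsInvariantForm B
  gradedForm : IsGradedForm T.toLocal.gminGrading B
  extends_local : ∀ a b : Module.Dual ℂ T.V × T.g₀ × T.V,
    B (T.toLocal.toGmin a) (T.toLocal.toGmin b) = T.localForm a b

end FundamentalTriplet

end

/-! A transitive quadratic graded Lie algebra is determined by its local part, and the local part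
together with the form carries the same data as a fundamental triplet.

From algebras to triplets: nondegeneracy identifies the component of degree `-1` with the dual of
`V`, the component of degree `1`, and invariance then forces `B([X,Y],U) = Y(U.X)`, so every bracket
of the local part comes from `(g₀, B₀, V)` (`exists_isLocalModel`). Transitivity in degree `0` makes
the representation faithful. A functional that kills `g₀.V` is an element of degree `-1` commuting
with degree `1`, hence zero, so `g₀.V` spans `V`; the dual statement is symmetric
(`triplet_admissible`).

From triplets to algebras: `Γ` must survive in the maximal algebra. This is seen by letting that
algebra act on the tensor algebra of `V` tensored with a `g₀`-module (`exists_inducedRep`). An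
endomorphism scaling degree `n` by `2^n` separates the degrees, and `g₀` together with iterated
brackets of only `V` or only `V*` spans everything, so the components of degrees `-1, 0, 1` are
exactly those of `Γ` and all components are finite-dimensional. In the minimal quotient, an element
of degree at least `2` in absolute value which violates transitivity generates an ideal that avoids
the local part, hence is zero (`gmin_eq_zero_of_lie_eq_zero`); in degrees `-1, 0, 1` transitivity is
admissibility of the triplet.

The form is built as a module map from the algebra to its dual: its graph is the submodule generated
by the local graph. This is a graph because a functional `f` with `(0, f)` in it kills the local
part, and the common kernel of these functionals is stable under the algebra
(`IsLocalForm.exists_extension`). Uniqueness follows because the local part generates.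

Finally, two transitive quadratic algebras with the same local model are isomorphic by a Goursat
argument: the subalgebra of the product generated by the diagonal local part meets each factor
trivially, by transitivity (`IsLocalModel.exists_iso`). This makes the map well defined and
surjective. It is injective because an isomorphism restricts to degrees `0` and `1`
(`IsLocalModel.iso_triplet`). -/

noncomputable section

/-! ### Subspaces stable under a generating set. -/

section Generation

variable {g M : Type*} [LieRing g] [LieAlgebra ℂ g] [AddCommGroup M] [Module ℂ M]
  [LieRingModule g M] [LieModule ℂ g M]

/-- A subspace stable under a generating set of a Lie algebra is stable under the Lie algebra. -/
theorem lie_mem_of_lieSpan {s : Set g} {N : Submodule ℂ M}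
    (h : ∀ a ∈ s, ∀ m ∈ N, ⁅a, m⁆ ∈ N) {x : g} (hx : x ∈ LieSubalgebra.lieSpan ℂ g s) :
    ∀ m ∈ N, ⁅x, m⁆ ∈ N := by
  induction hx using LieSubalgebra.lieSpan_induction with
  | mem x hx => exact h x hx
  | zero => intro m _; simp
  | add x y _ _ hx hy => intro m hm; rw [add_lie]; exact N.add_mem (hx m hm) (hy m hm)
  | smul c x _ hx => intro m hm; rw [smul_lie]; exact N.smul_mem c (hx m hm)
  | lie x y _ _ hx hy =>
    intro m hm
    rw [lie_lie]
    exact N.sub_mem (hx _ (hy m hm)) (hy _ (hx m hm))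

/-- A subspace stable under the adjoint action and containing a generating set is everything. -/
theorem mem_of_lieSpan_eq_top {s : Set g} (hs : LieSubalgebra.lieSpan ℂ g s = ⊤)
    {N : Submodule ℂ g} (hsN : ∀ a ∈ s, a ∈ N) (h : ∀ x : g, ∀ m ∈ N, ⁅x, m⁆ ∈ N) (x : g) :
    x ∈ N := by
  have hx : x ∈ LieSubalgebra.lieSpan ℂ g s := hs ▸ LieSubalgebra.mem_top x
  induction hx using LieSubalgebra.lieSpan_induction with
  | mem x hx => exact hsN x hx
  | zero => exact N.zero_mem
  | add x y _ _ hx hy => exact N.add_mem hx hy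
  | smul c x _ hx => exact N.smul_mem c hx
  | lie x y _ _ hx hy => exact h x y hy

end Generation

theorem lie_mem_comm {g : Type*} [LieRing g] [LieAlgebra ℂ g] {a b c : Submodule ℂ g}
    (h : ∀ y ∈ b, ∀ x ∈ a, ⁅y, x⁆ ∈ c) : ∀ x ∈ a, ∀ y ∈ b, ⁅x, y⁆ ∈ c := by
  intro x hx y hy
  rw [← lie_skew]
  exact neg_mem (h y hy x hx)

/-! ### Iterated brackets over a local part. -/

section Tower

variable {g M : Type*} [LieRing g] [LieAlgebra ℂ g] [AddCommGroup M] [Module ℂ M]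
  [LieRingModule g M] [LieModule ℂ g M]

/-- The spans of the iterated brackets `[x₁, [x₂, …, [xₖ, d]]]` with `xᵢ ∈ a` and `d ∈ D`. -/
def lieTower (a : Submodule ℂ g) (D : Submodule ℂ M) : ℕ → Submodule ℂ M
  | 0 => D
  | k + 1 => Submodule.map₂ (LieModule.toEnd ℂ g M : g →ₗ[ℂ] Module.End ℂ M) a (lieTower a D k)

variable {a b c : Submodule ℂ g} {D : Submodule ℂ M}

theorem lie_mem_lieTower_succ {k : ℕ} {x : g} (hx : x ∈ a) {m : M} (hm : m ∈ lieTower a D k) :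
    ⁅x, m⁆ ∈ lieTower a D (k + 1) :=
  Submodule.apply_mem_map₂ (LieModule.toEnd ℂ g M : g →ₗ[ℂ] Module.End ℂ M) hx hm

theorem lieTower_succ_le {k : ℕ} {N : Submodule ℂ M} :
    lieTower a D (k + 1) ≤ N ↔ ∀ x ∈ a, ∀ m ∈ lieTower a D k, ⁅x, m⁆ ∈ N :=
  Submodule.map₂_le

theorem lieTower_stable (hca : ∀ u ∈ c, ∀ x ∈ a, ⁅u, x⁆ ∈ a) (hcD : ∀ u ∈ c, ∀ d ∈ D, ⁅u, d⁆ ∈ D)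
    {u : g} (hu : u ∈ c) : ∀ k, ∀ m ∈ lieTower a D k, ⁅u, m⁆ ∈ lieTower a D k := by
  intro k
  induction k with
  | zero => exact hcD u hu
  | succ k ih =>
    refine fun m hm => (lieTower_succ_le (N := (lieTower a D (k + 1)).comap
      (LieModule.toEnd ℂ g M u))).2 (fun x hx w hw => ?_) hm
    rw [Submodule.mem_comap, LieModule.toEnd_apply_apply, leibniz_lie]
    exact add_mem (lie_mem_lieTower_succ (hca u hu x hx) hw) (lie_mem_lieTower_succ hx (ih w hw))

/-- Everything rests on `[y,[x,w]] = [[y,x],w] + [x,[y,w]]`. At the bottom of the tower `[y,w]` may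
leave it, so only the round trip `[x,[y,w]]` is assumed to return to `D`. -/
theorem lieTower_lower (hca : ∀ u ∈ c, ∀ x ∈ a, ⁅u, x⁆ ∈ a)
    (hcD : ∀ u ∈ c, ∀ d ∈ D, ⁅u, d⁆ ∈ D) (hba : ∀ y ∈ b, ∀ x ∈ a, ⁅y, x⁆ ∈ c)
    (habD : ∀ x ∈ a, ∀ y ∈ b, ∀ d ∈ D, ⁅x, ⁅y, d⁆⁆ ∈ D) {y : g} (hy : y ∈ b) :
    ∀ k, ∀ m ∈ lieTower a D (k + 1), ⁅y, m⁆ ∈ lieTower a D k := by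
  intro k
  induction k with
  | zero =>
    refine fun m hm => (lieTower_succ_le (N := (lieTower a D 0).comap
      (LieModule.toEnd ℂ g M y))).2 (fun x hx w hw => ?_) hm
    rw [Submodule.mem_comap, LieModule.toEnd_apply_apply, leibniz_lie]
    exact add_mem (hcD _ (hba y hy x hx) w hw) (habD x hx y hy w hw)
  | succ k ih =>
    refine fun m hm => (lieTower_succ_le (N := (lieTower a D (k + 1)).comap
      (LieModule.toEnd ℂ g M y))).2 (fun x hx w hw => ?_) hm
    rw [Submodule.mem_comap, LieModule.toEnd_apply_apply, leibniz_lie]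
    exact add_mem (lieTower_stable hca hcD (hba y hy x hx) _ w hw)
      (lie_mem_lieTower_succ hx (ih w hw))

theorem lieTower_fg (ha : a.FG) (hD : D.FG) : ∀ k, (lieTower a D k).FG
  | 0 => hD
  | k + 1 => Submodule.FG.map₂ _ ha (lieTower_fg ha hD k)

/-- The tower over `D₀`, upwards by `ap` from `Dp` and downwards by `am` from `Dm`. -/
def localTower (am ap : Submodule ℂ g) (Dm D₀ Dp : Submodule ℂ M) : ℤ → Submodule ℂ M
  | Int.ofNat 0 => D₀
  | Int.ofNat (k + 1) => lieTower ap Dp k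
  | Int.negSucc k => lieTower am Dm k

/-- The subspaces `am, a₀, ap` of a Lie algebra behave as a local part, and the subspaces
`Dm, D₀, Dp` of a module are stable under the brackets which stay in degrees `-1, 0, 1`. -/
structure IsLocalAction (am a₀ ap : Submodule ℂ g) (Dm D₀ Dp : Submodule ℂ M) : Prop where
  zero_neg : ∀ u ∈ a₀, ∀ y ∈ am, ⁅u, y⁆ ∈ am
  zero_pos : ∀ u ∈ a₀, ∀ x ∈ ap, ⁅u, x⁆ ∈ ap
  neg_pos : ∀ y ∈ am, ∀ x ∈ ap, ⁅y, x⁆ ∈ a₀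
  zero_Dm : ∀ u ∈ a₀, ∀ d ∈ Dm, ⁅u, d⁆ ∈ Dm
  zero_D₀ : ∀ u ∈ a₀, ∀ d ∈ D₀, ⁅u, d⁆ ∈ D₀
  zero_Dp : ∀ u ∈ a₀, ∀ d ∈ Dp, ⁅u, d⁆ ∈ Dp
  pos_D₀ : ∀ x ∈ ap, ∀ d ∈ D₀, ⁅x, d⁆ ∈ Dp
  neg_D₀ : ∀ y ∈ am, ∀ d ∈ D₀, ⁅y, d⁆ ∈ Dm
  pos_Dm : ∀ x ∈ ap, ∀ d ∈ Dm, ⁅x, d⁆ ∈ D₀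
  neg_Dp : ∀ y ∈ am, ∀ d ∈ Dp, ⁅y, d⁆ ∈ D₀

namespace IsLocalAction

variable {am a₀ ap : Submodule ℂ g} {Dm D₀ Dp : Submodule ℂ M}

theorem lie_zero_mem (h : IsLocalAction am a₀ ap Dm D₀ Dp) {u : g} (hu : u ∈ a₀) :
    ∀ n, ∀ m ∈ localTower am ap Dm D₀ Dp n, ⁅u, m⁆ ∈ localTower am ap Dm D₀ Dp n
  | Int.ofNat 0 => h.zero_D₀ u hu
  | Int.ofNat (k + 1) => lieTower_stable h.zero_pos h.zero_Dp hu k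
  | Int.negSucc k => lieTower_stable h.zero_neg h.zero_Dm hu k

theorem lie_pos_mem (h : IsLocalAction am a₀ ap Dm D₀ Dp) {x : g} (hx : x ∈ ap) :
    ∀ n, ∀ m ∈ localTower am ap Dm D₀ Dp n, ⁅x, m⁆ ∈ localTower am ap Dm D₀ Dp (n + 1)
  | Int.ofNat 0 => h.pos_D₀ x hx
  | Int.ofNat (_ + 1) => fun _ hm => lie_mem_lieTower_succ hx hm
  | Int.negSucc 0 => h.pos_Dm x hx
  | Int.negSucc (k + 1) => lieTower_lower h.zero_neg h.zero_Dm (lie_mem_comm h.neg_pos)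
      (fun y hy x hx d hd => h.neg_D₀ y hy _ (h.pos_Dm x hx d hd)) hx k

theorem lie_neg_mem (h : IsLocalAction am a₀ ap Dm D₀ Dp) {y : g} (hy : y ∈ am) :
    ∀ n, ∀ m ∈ localTower am ap Dm D₀ Dp n, ⁅y, m⁆ ∈ localTower am ap Dm D₀ Dp (n - 1)
  | Int.ofNat 0 => h.neg_D₀ y hy
  | Int.ofNat 1 => h.neg_Dp y hy
  | Int.ofNat (k + 2) => by
    -- Degree `j + 1` of the integer-indexed tower is level `j` of `lieTower`, so this case lowers
    -- level `k + 1` to level `k`.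
    have e : Int.ofNat (k + 2) - 1 = Int.ofNat (k + 1) := by
      simp only [Int.ofNat_eq_natCast]; push_cast; ring
    rw [e]
    exact lieTower_lower h.zero_pos h.zero_Dp h.neg_pos
      (fun x hx y hy d hd => h.pos_D₀ x hx _ (h.neg_Dp y hy d hd)) hy k
  | Int.negSucc _ => fun _ hm => lie_mem_lieTower_succ hy hm

/-- The sum of the tower is stable under the local part. -/
theorem lie_mem_iSup (h : IsLocalAction am a₀ ap Dm D₀ Dp) :
    ∀ z ∈ (am : Set g) ∪ (a₀ : Set g) ∪ (ap : Set g), ∀ m ∈ ⨆ n, localTower am ap Dm D₀ Dp n,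
      ⁅z, m⁆ ∈ ⨆ n, localTower am ap Dm D₀ Dp n := by
  intro z hz
  suffices H : (⨆ n, localTower am ap Dm D₀ Dp n) ≤
      (⨆ n, localTower am ap Dm D₀ Dp n).comap (LieModule.toEnd ℂ g M z) from fun m hm => H hm
  refine iSup_le fun n m hm => ?_
  rw [Submodule.mem_comap, LieModule.toEnd_apply_apply]
  rcases hz with (hz | hz) | hz
  · exact Submodule.mem_iSup_of_mem _ (h.lie_neg_mem hz n m hm)
  · exact Submodule.mem_iSup_of_mem _ (h.lie_zero_mem hz n m hm)
  · exact Submodule.mem_iSup_of_mem _ (h.lie_pos_mem hz n m hm)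

end IsLocalAction

theorem localTower_le {am ap : Submodule ℂ g} {Dm D₀ Dp : Submodule ℂ M} {gr : ℤ → Submodule ℂ M}
    (hneg : ∀ y ∈ am, ∀ n, ∀ m ∈ gr n, ⁅y, m⁆ ∈ gr (n - 1))
    (hpos : ∀ x ∈ ap, ∀ n, ∀ m ∈ gr n, ⁅x, m⁆ ∈ gr (n + 1))
    (hDm : Dm ≤ gr (-1)) (hD₀ : D₀ ≤ gr 0) (hDp : Dp ≤ gr 1) :
    ∀ n, localTower am ap Dm D₀ Dp n ≤ gr n
  | Int.ofNat 0 => hD₀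
  | Int.ofNat (k + 1) => by
    change lieTower ap Dp k ≤ gr ((k : ℤ) + 1)
    induction k with
    | zero => simpa [lieTower] using hDp
    | succ k ih =>
      refine lieTower_succ_le.2 fun x hx m hm => ?_
      push_cast
      exact hpos x hx _ m (ih hm)
  | Int.negSucc k => by
    change lieTower am Dm k ≤ gr (Int.negSucc k)
    induction k with
    | zero => exact hDm
    | succ k ih => exact lieTower_succ_le.2 fun y hy m hm => hneg y hy _ m (ih hm)

theorem localTower_fg {am ap : Submodule ℂ g} {Dm D₀ Dp : Submodule ℂ M} (ham : am.FG)
    (hap : ap.FG) (hDm : Dm.FG) (hD₀ : D₀.FG) (hDp : Dp.FG) :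
    ∀ n, (localTower am ap Dm D₀ Dp n).FG
  | Int.ofNat 0 => hD₀
  | Int.ofNat (k + 1) => lieTower_fg hap hDp k
  | Int.negSucc k => lieTower_fg ham hDm k

end Tower

/-! ### Linear algebra of graded spaces. -/

section GradedSpace

variable {M E : Type*} [AddCommGroup M] [Module ℂ M] [AddCommGroup E] [Module ℂ E]

/-- Modular law: `S n` and the other components of `gr` together span, and intersecting with `gr n`
removes the latter. This is how a tower of iterated brackets is recognised as the full grading. -/
theorem iSupIndep_eq_of_le {gr S : ℤ → Submodule ℂ M} (hind : iSupIndep gr)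
    (hle : ∀ n, S n ≤ gr n) (htop : ⨆ n, S n = ⊤) (n : ℤ) : S n = gr n := by
  refine le_antisymm (hle n) ?_
  have h1 : S n ⊔ ⨆ (j) (_ : j ≠ n), gr j = ⊤ := by
    rw [eq_top_iff, ← htop]
    refine iSup_le fun j => ?_
    by_cases hj : j = n
    · subst hj; exact le_sup_left
    · exact (hle j).trans ((le_iSup₂_of_le (f := fun (j : ℤ) (_ : j ≠ n) => gr j) j hj
        le_rfl).trans le_sup_right)
  have h2 : gr n ≤ (S n ⊔ ⨆ (j) (_ : j ≠ n), gr j) ⊓ gr n := by rw [h1, top_inf_eq]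
  rw [sup_inf_assoc_of_le _ (hle n), (hind n).symm.eq_bot, sup_bot_eq] at h2
  exact h2

/-- If a sum of vectors of distinct degrees vanishes, so does each of them. -/
theorem eq_zero_of_iSupIndep {gr : ℤ → Submodule ℂ M} (hind : iSupIndep gr) {s : Finset ℤ}
    {f : ℤ → M} (hf : ∀ n ∈ s, f n ∈ gr n) (h0 : ∑ n ∈ s, f n = 0) : ∀ n ∈ s, f n = 0 := by
  intro n hn
  rw [← Finset.add_sum_erase s f hn] at h0
  refine (Submodule.disjoint_def.1 (hind n)) _ (hf n hn) ?_
  rw [eq_neg_of_add_eq_zero_left h0]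
  refine neg_mem (Submodule.sum_mem _ fun j hj => ?_)
  exact Submodule.mem_iSup_of_mem j (Submodule.mem_iSup_of_mem (Finset.ne_of_mem_erase hj)
    (hf j (Finset.mem_of_mem_erase hj)))

/-- An element of a sum of subspaces, written as a finite sum. -/
theorem exists_finset_sum_of_mem_iSup {S : ℤ → Submodule ℂ M} {x : M} (hx : x ∈ ⨆ n, S n) :
    ∃ (s : Finset ℤ) (f : ℤ → M), (∀ n, f n ∈ S n) ∧ (∀ n, n ∉ s → f n = 0) ∧
      x = ∑ n ∈ s, f n := by
  obtain ⟨f, hf, rfl⟩ := (Submodule.mem_iSup_iff_exists_finsupp S x).1 hx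
  exact ⟨f.support, f, hf, fun n hn => Finsupp.notMem_support_iff.1 hn, rfl⟩

/-- The coordinate on a component of a graded space, through an isomorphism of it with `E`. -/
theorem exists_coordinate {gr : ℤ → Submodule ℂ M} (hgr : DirectSum.IsInternal gr) {n : ℤ}
    {f : E →ₗ[ℂ] M} (hf : Function.Injective f) (hr : LinearMap.range f = gr n) :
    ∃ p : M →ₗ[ℂ] E, (∀ e, p (f e) = e) ∧ ∀ j, j ≠ n → ∀ m ∈ gr j, p m = 0 := by
  have hc : IsCompl (gr n) (⨆ (j) (_ : j ≠ n), gr j) := by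
    refine ⟨hgr.submodule_iSupIndep n, codisjoint_iff.2 ?_⟩
    rw [eq_top_iff, ← hgr.submodule_iSup_eq_top]
    refine iSup_le fun j => ?_
    by_cases hj : j = n
    · subst hj; exact le_sup_left
    · exact (le_iSup₂_of_le (f := fun (j : ℤ) (_ : j ≠ n) => gr j) j hj le_rfl).trans le_sup_right
  have hmem : ∀ e, f e ∈ gr n := fun e => hr ▸ LinearMap.mem_range_self f e
  let e : E ≃ₗ[ℂ] gr n := LinearEquiv.ofBijective (f.codRestrict (gr n) hmem)
    ⟨fun a b h => hf (congrArg Subtype.val h), fun ⟨y, hy⟩ => by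
      obtain ⟨x, rfl⟩ := hr.symm ▸ hy
      exact ⟨x, rfl⟩⟩
  refine ⟨e.symm.toLinearMap ∘ₗ (gr n).projectionOnto _ hc, fun x => ?_,
    fun j hj m hm => ?_⟩
  · have : f x = (e x : M) := rfl
    rw [LinearMap.comp_apply, this, Submodule.projectionOnto_apply_left]
    simp
  · rw [LinearMap.comp_apply, (Submodule.projectionOnto_apply_eq_zero_iff hc).2, map_zero]
    exact Submodule.mem_iSup_of_mem j (Submodule.mem_iSup_of_mem hj hm)

end GradedSpace

/-! ### Invariant graded forms and transitivity. -/

section GradedForms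

variable {L : Type u} [LieRing L] [LieAlgebra ℂ L] {gr : ℤ → Submodule ℂ L}

theorem linearMap_eq_of_graded {N : Type*} [AddCommGroup N] [Module ℂ N]
    (hgr : ⨆ n, gr n = ⊤) {f f' : L →ₗ[ℂ] N} (h : ∀ n, ∀ x ∈ gr n, f x = f' x) : f = f' := by
  have : (⨆ n, gr n) ≤ LinearMap.eqLocus f f' := iSup_le fun n x hx => h n x hx
  rw [hgr] at this
  exact LinearMap.ext fun x => this (Submodule.mem_top (x := x))

/-- An invariant graded form is determined by its values on the local part. -/
theorem IsInvariantForm.eq_of_local (hgr : IsGradedLieAlgebra gr) {B B' : LinearMap.BilinForm ℂ L}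
    (hB : IsInvariantForm B) (hB' : IsInvariantForm B') (hg : IsGradedForm gr B)
    (hg' : IsGradedForm gr B')
    (h : ∀ i : ℤ, -1 ≤ i → i ≤ 1 → ∀ x ∈ gr i, ∀ y ∈ gr (-i), B x y = B' x y) : B = B' := by
  have hloc : ∀ i : ℤ, -1 ≤ i → i ≤ 1 → ∀ x ∈ gr i, B x = B' x := by
    intro i h1 h2 x hx
    refine linearMap_eq_of_graded hgr.isInternal.submodule_iSup_eq_top fun n y hy => ?_
    by_cases hn : i = -n
    · obtain rfl : n = -i := by omega
      exact h i h1 h2 x hx y hy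
    · rw [hg i n hn x hx y hy, hg' i n hn x hx y hy]
  refine LinearMap.ext fun x => ?_
  refine mem_of_lieSpan_eq_top hgr.generated (N := LinearMap.eqLocus B B') ?_ ?_ x
  · rintro a ((ha | ha) | ha)
    · exact hloc (-1) (by norm_num) (by norm_num) a ha
    · exact hloc 0 (by norm_num) (by norm_num) a ha
    · exact hloc 1 (by norm_num) (by norm_num) a ha
  · intro z m hm
    replace hm : B m = B' m := hm
    change B ⁅z, m⁆ = B' ⁅z, m⁆
    refine LinearMap.ext fun c => ?_
    rw [← lie_skew, map_neg, map_neg, LinearMap.neg_apply, LinearMap.neg_apply, hB.invariant,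
      hB'.invariant, hm]

/-- A graded subspace of a transitive graded Lie algebra, stable under the components of degrees
`-1` and `1`, which meets the local part trivially, is zero. -/
theorem IsTransitiveGrading.eq_zero_of_local (ht : IsTransitiveGrading gr)
    {K : ℤ → Submodule ℂ L} (hK : ∀ n, K n ≤ gr n)
    (hneg : ∀ n, ∀ x ∈ K n, ∀ y ∈ gr (-1), ⁅x, y⁆ ∈ K (n - 1))
    (hpos : ∀ n, ∀ x ∈ K n, ∀ y ∈ gr 1, ⁅x, y⁆ ∈ K (n + 1))
    (h0 : ∀ n : ℤ, -1 ≤ n → n ≤ 1 → ∀ x ∈ K n, x = 0) (n : ℤ) : ∀ x ∈ K n, x = 0 := by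
  -- Induction outwards from degree `0`: brackets with degree `-1` land in the previous component,
  -- already zero, and transitivity applies. Negative degrees are symmetric.
  have hp : ∀ k : ℕ, ∀ x ∈ K k, x = 0 := by
    intro k
    induction k with
    | zero => exact h0 _ (by norm_num) (by norm_num)
    | succ k ih =>
      intro x hx
      refine ht.nonneg _ (by positivity) x (hK _ hx) fun y hy => ih _ ?_
      have := hneg _ x hx y hy
      rwa [Nat.cast_succ, add_sub_cancel_right] at this
  have hm : ∀ k : ℕ, ∀ x ∈ K (-(k : ℤ)), x = 0 := by
    intro k
    induction k with
    | zero => exact h0 _ (by norm_num) (by norm_num)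
    | succ k ih =>
      intro x hx
      refine ht.nonpos _ (by simp) x (hK _ hx) fun y hy => ih _ ?_
      have := hpos _ x hx y hy
      rwa [Nat.cast_succ, neg_add, neg_add_cancel_right] at this
  obtain ⟨k, rfl | rfl⟩ := n.eq_nat_or_neg
  · exact hp k
  · exact hm k

/-- The degree-`n` component of the radical, for a graded form. -/
theorem IsGradedForm.eq_zero_of_forall {B : LinearMap.BilinForm ℂ L} (hg : IsGradedForm gr B)
    (htop : ⨆ n, gr n = ⊤) {n : ℤ} {x : L} (hx : x ∈ gr n) (h : ∀ y ∈ gr (-n), B x y = 0) :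
    B x = 0 := by
  refine linearMap_eq_of_graded htop fun j y hy => ?_
  by_cases hj : n = -j
  · obtain rfl : j = -n := by omega
    exact h y hy
  · exact hg n j hj x hx y hy

/-- The homogeneous parts of the radical are stable under brackets and vanish in the local degrees,
so transitivity kills them. Gradedness of the form reduces an arbitrary element of the radical to
its homogeneous components. -/
theorem IsInvariantForm.nondegenerate (hgr : IsGradedLieAlgebra gr) (ht : IsTransitiveGrading gr)
    {B : LinearMap.BilinForm ℂ L} (hB : IsInvariantForm B) (hg : IsGradedForm gr B)
    (h : ∀ i : ℤ, -1 ≤ i → i ≤ 1 → ∀ x ∈ gr i, (∀ y ∈ gr (-i), B x y = 0) → x = 0) :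
    B.Nondegenerate := by
  have htop := hgr.isInternal.submodule_iSup_eq_top
  have hK : ∀ n, ∀ x ∈ gr n ⊓ LinearMap.ker B, x = 0 := by
    refine ht.eq_zero_of_local (fun n => inf_le_left) ?_ ?_ ?_
    · intro n x hx y hy
      refine ⟨hgr.lie_mem n (-1) x hx.1 y hy, LinearMap.ext fun c => ?_⟩
      rw [hB.invariant, LinearMap.mem_ker.1 hx.2]
      rfl
    · intro n x hx y hy
      refine ⟨hgr.lie_mem n 1 x hx.1 y hy, LinearMap.ext fun c => ?_⟩
      rw [hB.invariant, LinearMap.mem_ker.1 hx.2]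
      rfl
    · intro n h1 h2 x hx
      exact h n h1 h2 x hx.1 fun y _ => by rw [LinearMap.mem_ker.1 hx.2]; rfl
  have hleft : ∀ x, (∀ y, B x y = 0) → x = 0 := by
    intro x hx
    obtain ⟨s, f, hf, -, rfl⟩ := exists_finset_sum_of_mem_iSup
      (htop ▸ Submodule.mem_top : x ∈ ⨆ n, gr n)
    refine Finset.sum_eq_zero fun n hn => hK n _ ⟨hf n, ?_⟩
    refine hg.eq_zero_of_forall htop (hf n) fun y hy => ?_
    have := hx y
    rw [map_sum, LinearMap.sum_apply, Finset.sum_eq_single n] at this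
    · exact this
    · intro m _ hm
      exact hg m (-n) (by simpa using hm) _ (hf m) y hy
    · exact fun h => absurd hn h
  exact ⟨hleft, fun y hy => hleft y fun x => (hB.symm y x).trans (hy x)⟩

theorem IsTransitiveQuadratic.eq_zero_of_forall {B : LinearMap.BilinForm ℂ L}
    (h : IsTransitiveQuadratic gr B) {n : ℤ} {x : L} (hx : x ∈ gr n)
    (h0 : ∀ y ∈ gr (-n), B x y = 0) : x = 0 := by
  have := h.gradedForm.eq_zero_of_forall h.graded.isInternal.submodule_iSup_eq_top hx h0
  exact h.nondegenerate.1 x fun y => by rw [this]; rfl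

end GradedForms

/-! ### Extending a form from the local part. -/

section ProdModule

variable {L M N : Type*} [LieRing L] [AddCommGroup M] [LieRingModule L M] [AddCommGroup N]
  [LieRingModule L N]

/-- Intended for `L × L*`: a bilinear form is invariant exactly when the graph of the associated map
from `L` to `L*` is stable under this diagonal action. -/
instance prodLieRingModule : LieRingModule L (M × N) where
  bracket x p := (⁅x, p.1⁆, ⁅x, p.2⁆)
  add_lie x y p := by ext <;> simp
  lie_add x p q := by ext <;> simp
  leibniz_lie x y p := by ext <;> simp

theorem prod_lie (x : L) (p : M × N) : ⁅x, p⁆ = (⁅x, p.1⁆, ⁅x, p.2⁆) := rfl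

instance prodLieModule [LieAlgebra ℂ L] [Module ℂ M] [LieModule ℂ L M] [Module ℂ N]
    [LieModule ℂ L N] : LieModule ℂ L (M × N) where
  smul_lie c x p := by ext <;> simp [prod_lie]
  lie_smul c x p := by ext <;> simp [prod_lie]

end ProdModule

section FormExtension

variable {L : Type u} [LieRing L] [LieAlgebra ℂ L] {gr : ℤ → Submodule ℂ L}

/-- The graph, in degree `n`, of a bilinear form seen as a map to the dual. -/
def formGraph (gr : ℤ → Submodule ℂ L) (β : LinearMap.BilinForm ℂ L) (n : ℤ) :
    Submodule ℂ (L × Module.Dual ℂ L) :=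
  (gr n).map (LinearMap.prod LinearMap.id β)

theorem mem_formGraph {β : LinearMap.BilinForm ℂ L} {n : ℤ} {p : L × Module.Dual ℂ L} :
    p ∈ formGraph gr β n ↔ p.1 ∈ gr n ∧ p.2 = β p.1 := by
  constructor
  · rintro ⟨a, ha, rfl⟩
    exact ⟨ha, rfl⟩
  · rintro ⟨h1, h2⟩
    exact ⟨p.1, h1, Prod.ext rfl h2.symm⟩

/-- `β` is graded, symmetric, and invariant as far as the local part is concerned. -/
structure IsLocalForm (gr : ℤ → Submodule ℂ L) (β : LinearMap.BilinForm ℂ L) : Prop where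
  gradedForm : IsGradedForm gr β
  symm : ∀ x y, β x y = β y x
  invariant : ∀ i k : ℤ, -1 ≤ i → i ≤ 1 → -1 ≤ k → k ≤ 1 → -1 ≤ i + k → i + k ≤ 1 →
    ∀ a ∈ gr i, ∀ z ∈ gr k, ∀ c ∈ gr (-(i + k)), β ⁅a, z⁆ c = β a ⁅z, c⁆

variable {β : LinearMap.BilinForm ℂ L}

/-- Stability of the graph is local invariance rewritten: the dual action gives `(z.β a)(c) = -β a
[z,c]`, which is `β [z,a] c`. In the degrees of `c` not covered by the invariance hypothesis both
sides vanish. -/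
theorem IsLocalForm.lie_mem_formGraph (hβ : IsLocalForm gr β) (hgr : IsGradedLieAlgebra gr)
    {i k : ℤ} (hi : -1 ≤ i ∧ i ≤ 1) (hk : -1 ≤ k ∧ k ≤ 1) (hik : -1 ≤ k + i ∧ k + i ≤ 1) :
    ∀ z ∈ gr k, ∀ p ∈ formGraph gr β i, ⁅z, p⁆ ∈ formGraph gr β (k + i) := by
  intro z hz p hp
  rw [mem_formGraph] at hp ⊢
  refine ⟨hgr.lie_mem k i z hz _ hp.1, ?_⟩
  refine linearMap_eq_of_graded hgr.isInternal.submodule_iSup_eq_top fun n c hc => ?_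
  rw [prod_lie, Module.Dual.lie_apply, hp.2]
  by_cases hn : n = -(i + k)
  · subst hn
    have := hβ.invariant i k hi.1 hi.2 hk.1 hk.2 (by omega) (by omega) p.1 hp.1 z hz c hc
    rw [← this, ← lie_skew, map_neg, LinearMap.neg_apply, neg_neg]
  · rw [hβ.gradedForm i (k + n) (by omega) _ hp.1 _ (hgr.lie_mem k n z hz c hc), neg_zero,
      hβ.gradedForm (k + i) n (by omega) _ (hgr.lie_mem k i z hz _ hp.1) _ hc]

/-- An invariant form on the local part extends to the graded Lie algebra. The extension, seen as
a map to the dual, has as its graph the submodule generated by the graph of the local form. -/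
theorem IsLocalForm.exists_extension (hβ : IsLocalForm gr β) (hgr : IsGradedLieAlgebra gr) :
    ∃ B : LinearMap.BilinForm ℂ L, IsInvariantForm B ∧ IsGradedForm gr B ∧
      ∀ i : ℤ, -1 ≤ i → i ≤ 1 → ∀ x ∈ gr i, B x = β x := by
  have htop := hgr.isInternal.submodule_iSup_eq_top
  have hind := hgr.isInternal.submodule_iSupIndep
  let T : ℤ → Submodule ℂ (L × Module.Dual ℂ L) := localTower (gr (-1)) (gr 1)
    (formGraph gr β (-1)) (formGraph gr β 0) (formGraph gr β 1)
  have hloc : IsLocalAction (gr (-1)) (gr 0) (gr 1) (formGraph gr β (-1)) (formGraph gr β 0)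
      (formGraph gr β 1) := by
    have key := fun (i k : ℤ) => hβ.lie_mem_formGraph hgr (i := i) (k := k)
    exact
    { zero_neg := hgr.lie_mem 0 (-1)
      zero_pos := hgr.lie_mem 0 1
      neg_pos := hgr.lie_mem (-1) 1
      zero_Dm := key (-1) 0 (by norm_num) (by norm_num) (by norm_num)
      zero_D₀ := key 0 0 (by norm_num) (by norm_num) (by norm_num)
      zero_Dp := key 1 0 (by norm_num) (by norm_num) (by norm_num)
      pos_D₀ := key 0 1 (by norm_num) (by norm_num) (by norm_num)
      neg_D₀ := key 0 (-1) (by norm_num) (by norm_num) (by norm_num)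
      pos_Dm := key (-1) 1 (by norm_num) (by norm_num) (by norm_num)
      neg_Dp := key 1 (-1) (by norm_num) (by norm_num) (by norm_num) }
  -- In degrees `-1, 0, 1` the tower is its starting data, so generating the submodule adds nothing
  -- there.
  have hTloc : ∀ i : ℤ, -1 ≤ i → i ≤ 1 → T i = formGraph gr β i := by
    intro i h1 h2
    interval_cases i <;> rfl
  let D : ℤ → Submodule ℂ (Module.Dual ℂ L) := fun n =>
    ⨅ (j : ℤ) (_ : n ≠ -j), (gr j).dualAnnihilator
  have hD : ∀ n f, f ∈ D n ↔ ∀ j, n ≠ -j → ∀ x ∈ gr j, f x = 0 := by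
    intro n f
    simp [D, Submodule.mem_iInf, Submodule.mem_dualAnnihilator]
  have hTle : ∀ n, T n ≤ (gr n).prod (D n) := by
    have hlie : ∀ k, ∀ z ∈ gr k, ∀ n, ∀ p ∈ (gr n).prod (D n),
        ⁅z, p⁆ ∈ (gr (k + n)).prod (D (k + n)) := by
      intro k z hz n p hp
      refine ⟨hgr.lie_mem k n z hz _ hp.1, (hD _ _).2 fun j hj x hx => ?_⟩
      rw [prod_lie, Module.Dual.lie_apply, neg_eq_zero]
      exact (hD n _).1 hp.2 (k + j) (by omega) _ (hgr.lie_mem k j z hz x hx)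
    have hG : ∀ n, formGraph gr β n ≤ (gr n).prod (D n) := by
      intro n p hp
      rw [mem_formGraph] at hp
      refine ⟨hp.1, (hD _ _).2 fun j hj x hx => ?_⟩
      rw [hp.2]
      exact hβ.gradedForm n j hj _ hp.1 x hx
    refine localTower_le (gr := fun n => (gr n).prod (D n)) ?_ ?_ (hG _) (hG _) (hG _)
    · intro y hy n m hm
      have := hlie (-1) y hy n m hm
      rwa [neg_add_eq_sub] at this
    · intro y hy n m hm
      have := hlie 1 y hy n m hm
      rwa [add_comm 1 n] at this
  let S := ⨆ n, T n
  have hS : ∀ z : L, ∀ p ∈ S, ⁅z, p⁆ ∈ S := fun z =>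
    lie_mem_of_lieSpan hloc.lie_mem_iSup (hgr.generated ▸ LieSubalgebra.mem_top z)
  have hTS : ∀ n, T n ≤ S := le_iSup T
  -- In a homogeneous decomposition of `(0, f)` all first coordinates vanish. On `gr i` only the
  -- summand of degree `-i` can contribute, and it lies on the graph of `β` over `0`.
  have hlocal0 : ∀ f, ((0 : L), f) ∈ S → ∀ i : ℤ, -1 ≤ i → i ≤ 1 → ∀ x ∈ gr i, f x = 0 := by
    intro f hf i h1 h2 x hx
    obtain ⟨s, t, ht, -, hsum⟩ := exists_finset_sum_of_mem_iSup hf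
    have h1' : ∑ n ∈ s, (t n).1 = 0 := by
      have := congrArg Prod.fst hsum
      rw [Prod.fst_sum] at this
      exact this.symm
    have hz := eq_zero_of_iSupIndep hind (fun n _ => (hTle n (ht n)).1) h1'
    have h2' : f = ∑ n ∈ s, (t n).2 := by
      have := congrArg Prod.snd hsum
      rw [Prod.snd_sum] at this
      exact this
    rw [h2', LinearMap.sum_apply]
    refine Finset.sum_eq_zero fun n hn => ?_
    by_cases hni : n = -i
    · subst hni
      have := ht (-i)
      rw [hTloc _ (by omega) (by omega), mem_formGraph] at this
      rw [this.2, hz _ hn, map_zero]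
      rfl
    · exact (hD n _).1 (hTle n (ht n)).2 i hni x hx
  have hzero : ∀ f, ((0 : L), f) ∈ S → f = 0 := by
    intro f hf
    refine LinearMap.ext fun x => ?_
    -- The common kernel of all vertical functionals: it contains the local part, and it is stable
    -- because `z.(0, f) = (0, z.f)` is again vertical.
    let Q : Submodule ℂ L := ⨅ (f : Module.Dual ℂ L) (_ : ((0 : L), f) ∈ S), LinearMap.ker f
    have hQ : ∀ x, x ∈ Q ↔ ∀ f, ((0 : L), f) ∈ S → f x = 0 := by
      intro x; simp [Q, Submodule.mem_iInf]
    refine (hQ x).1 (mem_of_lieSpan_eq_top hgr.generated ?_ ?_ x) f hf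
    · rintro a ((ha | ha) | ha)
      · exact (hQ a).2 fun f hf => hlocal0 f hf (-1) (by norm_num) (by norm_num) a ha
      · exact (hQ a).2 fun f hf => hlocal0 f hf 0 (by norm_num) (by norm_num) a ha
      · exact (hQ a).2 fun f hf => hlocal0 f hf 1 (by norm_num) (by norm_num) a ha
    · intro w z hz
      refine (hQ _).2 fun f hf => ?_
      have h1 := hS w _ hf
      rw [prod_lie, lie_zero] at h1
      have h2 := (hQ z).1 hz _ h1
      rwa [Module.Dual.lie_apply, neg_eq_zero] at h2
  have hex : ∀ a : L, ∃ f, (a, f) ∈ S := by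
    intro a
    have : a ∈ S.map (LinearMap.fst ℂ L (Module.Dual ℂ L)) := by
      have hl : ∀ i : ℤ, -1 ≤ i → i ≤ 1 → ∀ a ∈ gr i,
          a ∈ S.map (LinearMap.fst ℂ L (Module.Dual ℂ L)) := fun i h1 h2 a ha =>
        ⟨(a, β a), hTS i (by rw [hTloc i h1 h2, mem_formGraph]; exact ⟨ha, rfl⟩), rfl⟩
      refine mem_of_lieSpan_eq_top hgr.generated ?_ ?_ a
      · rintro a ((ha | ha) | ha)
        · exact hl (-1) (by norm_num) (by norm_num) a ha
        · exact hl 0 (by norm_num) (by norm_num) a ha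
        · exact hl 1 (by norm_num) (by norm_num) a ha
      · rintro w _ ⟨p, hp, rfl⟩
        exact ⟨⁅w, p⁆, hS w p hp, rfl⟩
    obtain ⟨p, hp, rfl⟩ := this
    exact ⟨p.2, hp⟩
  have huniq : ∀ a f f', (a, f) ∈ S → (a, f') ∈ S → f = f' := by
    intro a f f' h h'
    have := S.sub_mem h h'
    rw [Prod.mk_sub_mk, sub_self] at this
    exact sub_eq_zero.1 (hzero _ this)
  choose φ hφ using hex
  let B : LinearMap.BilinForm ℂ L :=
    { toFun := φ
      map_add' := fun a b => huniq (a + b) _ _ (hφ _) (S.add_mem (hφ a) (hφ b))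
      map_smul' := fun c a => huniq (c • a) _ _ (hφ _) (S.smul_mem c (hφ a)) }
  have hB : ∀ a f, (a, f) ∈ S → B a = f := fun a f h => huniq a _ _ (hφ a) h
  have hBlie : ∀ z a c : L, B ⁅z, a⁆ c = - B a ⁅z, c⁆ := by
    intro z a c
    have := hS z _ (hφ a)
    rw [prod_lie] at this
    rw [hB _ _ this, Module.Dual.lie_apply]
    rfl
  have hBinv : ∀ x y z : L, B ⁅x, y⁆ z = B x ⁅y, z⁆ := by
    intro x y z
    rw [← lie_skew, map_neg, LinearMap.neg_apply, hBlie, neg_neg]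
  have hBloc : ∀ i : ℤ, -1 ≤ i → i ≤ 1 → ∀ x ∈ gr i, B x = β x := fun i h1 h2 a ha =>
    hB a _ (hTS i (by rw [hTloc i h1 h2, mem_formGraph]; exact ⟨ha, rfl⟩))
  have hBgr : IsGradedForm gr B := by
    intro i j hij x hx y hy
    obtain ⟨s, t, ht, ht0, hsum⟩ := exists_finset_sum_of_mem_iSup (hφ x)
    have h1 : x = ∑ n ∈ s, (t n).1 := by
      have := congrArg Prod.fst hsum
      rwa [Prod.fst_sum] at this
    have h2 : B x = ∑ n ∈ s, (t n).2 := by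
      have := congrArg Prod.snd hsum
      rwa [Prod.snd_sum] at this
    -- The support `s` need not contain `i`; inserting it changes no sum, since `t` vanishes off
    -- `s`. Away from `i` the summands are then vertical, hence zero by `hzero`.
    have hz : ∀ n ∈ insert i s, (t n).1 - (if n = i then x else 0) = 0 := by
      refine eq_zero_of_iSupIndep hind (fun n _ => sub_mem (hTle n (ht n)).1 ?_) ?_
      · split_ifs with h
        · exact h ▸ hx
        · exact zero_mem _
      · rw [Finset.sum_sub_distrib, Finset.sum_ite_eq', if_pos (Finset.mem_insert_self _ _),
          sub_eq_zero]
        conv_rhs => rw [h1]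
        refine Finset.sum_insert_of_eq_zero_if_notMem fun hi => ?_
        rw [ht0 i hi]
        rfl
    rw [h2, LinearMap.sum_apply]
    refine Finset.sum_eq_zero fun n hn => ?_
    by_cases hni : n = i
    · subst hni
      exact (hD n _).1 (hTle n (ht n)).2 j hij y hy
    · have h3 := hz n (Finset.mem_insert_of_mem hn)
      rw [if_neg hni, sub_zero] at h3
      have h4 : ((0 : L), (t n).2) ∈ S := by
        rw [← h3]
        exact hTS n (ht n)
      rw [hzero _ h4]
      rfl
  refine ⟨B, ⟨?_, hBinv⟩, hBgr, hBloc⟩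
  -- The elements on which `B` agrees with its transpose form a subspace containing the local part
  -- and stable under brackets, by invariance.
  have hsymm : ∀ x, B x = LinearMap.flip B x := by
    intro x
    refine mem_of_lieSpan_eq_top hgr.generated (N := LinearMap.eqLocus B (LinearMap.flip B)) ?_ ?_ x
    · have hl : ∀ i : ℤ, -1 ≤ i → i ≤ 1 → ∀ a ∈ gr i, B a = LinearMap.flip B a := by
        intro i h1 h2 a ha
        refine linearMap_eq_of_graded htop fun j y hy => ?_
        rw [LinearMap.flip_apply]
        by_cases hij : i = -j
        · rw [hBloc i h1 h2 a ha, hBloc j (by omega) (by omega) y hy, hβ.symm]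
        · rw [hBgr i j hij a ha y hy, hBgr j i (by omega) y hy a ha]
      rintro a ((ha | ha) | ha)
      · exact hl (-1) (by norm_num) (by norm_num) a ha
      · exact hl 0 (by norm_num) (by norm_num) a ha
      · exact hl 1 (by norm_num) (by norm_num) a ha
    · intro z m hm
      replace hm : ∀ c, B m c = B c m := fun c => LinearMap.congr_fun
        (show B m = LinearMap.flip B m from hm) c
      refine LinearMap.ext fun c => ?_
      rw [LinearMap.flip_apply, hBlie, hm, ← hBinv, ← lie_skew c z, map_neg,
        LinearMap.neg_apply]
  exact fun x y => LinearMap.congr_fun (hsymm x) y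

end FormExtension

/-! ### Transitive algebras sharing a local part. -/

section LocalModel

variable {L L' : Type u} [LieRing L] [LieAlgebra ℂ L] [LieRing L'] [LieAlgebra ℂ L']

/-- `fm, f₀, fp` identify `V*, g₀, V` with the components of degrees `-1, 0, 1` of a graded Lie
algebra, compatibly with the brackets and the forms. -/
structure IsLocalModel (T : FundamentalTriplet.{u}) (gr : ℤ → Submodule ℂ L)
    (B : LinearMap.BilinForm ℂ L) (fm : Module.Dual ℂ T.V →ₗ[ℂ] L) (f₀ : T.g₀ →ₗ[ℂ] L)
    (fp : T.V →ₗ[ℂ] L) : Prop where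
  injective_neg : Function.Injective fm
  injective_zero : Function.Injective f₀
  injective_pos : Function.Injective fp
  range_neg : LinearMap.range fm = gr (-1)
  range_zero : LinearMap.range f₀ = gr 0
  range_pos : LinearMap.range fp = gr 1
  zero_zero : ∀ u v, ⁅f₀ u, f₀ v⁆ = f₀ ⁅u, v⁆
  zero_neg : ∀ u y, ⁅f₀ u, fm y⁆ = fm ⁅u, y⁆
  zero_pos : ∀ u x, ⁅f₀ u, fp x⁆ = fp ⁅u, x⁆
  pos_neg : ∀ x y, ⁅fp x, fm y⁆ = f₀ (T.bracket x y)
  form_zero : ∀ u v, B (f₀ u) (f₀ v) = T.B₀ u v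
  form_pos_neg : ∀ x y, B (fp x) (fm y) = y x

variable {T : FundamentalTriplet.{u}} {gr : ℤ → Submodule ℂ L} {gr' : ℤ → Submodule ℂ L'}
  {B : LinearMap.BilinForm ℂ L} {B' : LinearMap.BilinForm ℂ L'}
  {fm : Module.Dual ℂ T.V →ₗ[ℂ] L} {f₀ : T.g₀ →ₗ[ℂ] L} {fp : T.V →ₗ[ℂ] L}
  {fm' : Module.Dual ℂ T.V →ₗ[ℂ] L'} {f₀' : T.g₀ →ₗ[ℂ] L'} {fp' : T.V →ₗ[ℂ] L'}

namespace IsLocalModel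

theorem neg_mem (m : IsLocalModel T gr B fm f₀ fp) (y : Module.Dual ℂ T.V) : fm y ∈ gr (-1) :=
  m.range_neg ▸ LinearMap.mem_range_self fm y

theorem zero_mem (m : IsLocalModel T gr B fm f₀ fp) (u : T.g₀) : f₀ u ∈ gr 0 :=
  m.range_zero ▸ LinearMap.mem_range_self f₀ u

theorem pos_mem (m : IsLocalModel T gr B fm f₀ fp) (x : T.V) : fp x ∈ gr 1 :=
  m.range_pos ▸ LinearMap.mem_range_self fp x

theorem exists_neg (m : IsLocalModel T gr B fm f₀ fp) {a : L} (ha : a ∈ gr (-1)) :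
    ∃ y, fm y = a := by
  rwa [← m.range_neg] at ha

theorem exists_zero (m : IsLocalModel T gr B fm f₀ fp) {a : L} (ha : a ∈ gr 0) :
    ∃ u, f₀ u = a := by
  rwa [← m.range_zero] at ha

theorem exists_pos (m : IsLocalModel T gr B fm f₀ fp) {a : L} (ha : a ∈ gr 1) :
    ∃ x, fp x = a := by
  rwa [← m.range_pos] at ha

theorem isLocalAction (m : IsLocalModel T gr B fm f₀ fp) (m' : IsLocalModel T gr' B' fm' f₀' fp') :
    IsLocalAction (LinearMap.range (fm.prod fm')) (LinearMap.range (f₀.prod f₀'))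
      (LinearMap.range (fp.prod fp')) (LinearMap.range (fm.prod fm'))
      (LinearMap.range (f₀.prod f₀')) (LinearMap.range (fp.prod fp')) := by
  have zz : ∀ a ∈ LinearMap.range (f₀.prod f₀'), ∀ b ∈ LinearMap.range (f₀.prod f₀'),
      ⁅a, b⁆ ∈ LinearMap.range (f₀.prod f₀') := by
    rintro _ ⟨u, rfl⟩ _ ⟨v, rfl⟩
    exact ⟨⁅u, v⁆, Prod.ext (m.zero_zero u v).symm (m'.zero_zero u v).symm⟩
  have zm : ∀ a ∈ LinearMap.range (f₀.prod f₀'), ∀ b ∈ LinearMap.range (fm.prod fm'),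
      ⁅a, b⁆ ∈ LinearMap.range (fm.prod fm') := by
    rintro _ ⟨u, rfl⟩ _ ⟨v, rfl⟩
    exact ⟨⁅u, v⁆, Prod.ext (m.zero_neg u v).symm (m'.zero_neg u v).symm⟩
  have zp : ∀ a ∈ LinearMap.range (f₀.prod f₀'), ∀ b ∈ LinearMap.range (fp.prod fp'),
      ⁅a, b⁆ ∈ LinearMap.range (fp.prod fp') := by
    rintro _ ⟨u, rfl⟩ _ ⟨v, rfl⟩
    exact ⟨⁅u, v⁆, Prod.ext (m.zero_pos u v).symm (m'.zero_pos u v).symm⟩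
  have pm : ∀ a ∈ LinearMap.range (fp.prod fp'), ∀ b ∈ LinearMap.range (fm.prod fm'),
      ⁅a, b⁆ ∈ LinearMap.range (f₀.prod f₀') := by
    rintro _ ⟨x, rfl⟩ _ ⟨y, rfl⟩
    exact ⟨T.bracket x y, Prod.ext (m.pos_neg x y).symm (m'.pos_neg x y).symm⟩
  exact
  { zero_neg := zm
    zero_pos := zp
    neg_pos := lie_mem_comm pm
    zero_Dm := zm
    zero_D₀ := zz
    zero_Dp := zp
    pos_D₀ := lie_mem_comm zp
    neg_D₀ := lie_mem_comm zm
    pos_Dm := pm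
    neg_Dp := lie_mem_comm pm }

/-- Transitive quadratic graded Lie algebras with the same local part are isomorphic: the
subalgebra of the product generated by the diagonal of the local part is the graph of an
isomorphism. -/
theorem exists_iso (m : IsLocalModel T gr B fm f₀ fp) (m' : IsLocalModel T gr' B' fm' f₀' fp')
    (h : IsTransitiveQuadratic gr B) (h' : IsTransitiveQuadratic gr' B') :
    ∃ Ψ : L ≃ₗ⁅ℂ⁆ L', (∀ n x, x ∈ gr n ↔ Ψ x ∈ gr' n) ∧ ∀ x y, B' (Ψ x) (Ψ y) = B x y := by
  have hind := h.graded.isInternal.submodule_iSupIndep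
  have hind' := h'.graded.isInternal.submodule_iSupIndep
  have hloc := m.isLocalAction m'
  let am := LinearMap.range (fm.prod fm')
  let a₀ := LinearMap.range (f₀.prod f₀')
  let ap := LinearMap.range (fp.prod fp')
  let S : ℤ → Submodule ℂ (L × L') := localTower am ap am a₀ ap
  have hTle : ∀ n, S n ≤ (gr n).prod (gr' n) := by
    refine localTower_le (gr := fun n => (gr n).prod (gr' n)) ?_ ?_ ?_ ?_ ?_
    · rintro _ ⟨y, rfl⟩ n p hp
      have h1 := h.graded.lie_mem (-1) n _ (m.neg_mem y) _ hp.1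
      have h2 := h'.graded.lie_mem (-1) n _ (m'.neg_mem y) _ hp.2
      rw [neg_add_eq_sub] at h1 h2
      exact ⟨h1, h2⟩
    · rintro _ ⟨x, rfl⟩ n p hp
      have h1 := h.graded.lie_mem 1 n _ (m.pos_mem x) _ hp.1
      have h2 := h'.graded.lie_mem 1 n _ (m'.pos_mem x) _ hp.2
      rw [add_comm 1 n] at h1 h2
      exact ⟨h1, h2⟩
    · rintro _ ⟨y, rfl⟩
      exact ⟨m.neg_mem y, m'.neg_mem y⟩
    · rintro _ ⟨u, rfl⟩
      exact ⟨m.zero_mem u, m'.zero_mem u⟩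
    · rintro _ ⟨x, rfl⟩
      exact ⟨m.pos_mem x, m'.pos_mem x⟩
  have hTneg : ∀ n, ∀ p ∈ S n, ∀ y, ⁅p, (fm y, fm' y)⁆ ∈ S (n - 1) := by
    intro n p hp y
    rw [← lie_skew]
    exact Submodule.neg_mem _ (hloc.lie_neg_mem ⟨y, rfl⟩ n p hp)
  have hTpos : ∀ n, ∀ p ∈ S n, ∀ x, ⁅p, (fp x, fp' x)⁆ ∈ S (n + 1) := by
    intro n p hp x
    rw [← lie_skew]
    exact Submodule.neg_mem _ (hloc.lie_pos_mem ⟨x, rfl⟩ n p hp)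
  -- The second coordinates `x'` with `(0, x')` in `S n` form a graded subspace stable under degrees
  -- `-1` and `1`. In local degrees `S n` is the graph of a bijection, so transitivity makes the
  -- subspace zero.
  have hright : ∀ n, ∀ x' ∈ (S n).comap (LinearMap.inr ℂ L L'), x' = 0 := by
    refine h'.transitive.eq_zero_of_local (fun n x' hx' => (hTle n hx').2) ?_ ?_ ?_
    · intro n x' hx' y' hy'
      obtain ⟨y, rfl⟩ := m'.exists_neg hy'
      have := hTneg n _ hx' y
      rwa [LieAlgebra.Prod.bracket_apply, LinearMap.inr_apply, zero_lie] at this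
    · intro n x' hx' y' hy'
      obtain ⟨y, rfl⟩ := m'.exists_pos hy'
      have := hTpos n _ hx' y
      rwa [LieAlgebra.Prod.bracket_apply, LinearMap.inr_apply, zero_lie] at this
    · intro n h1 h2 x' hx'
      interval_cases n
      · obtain ⟨y, hy⟩ := hx'
        rw [LinearMap.prod_apply, Function.prod_apply, LinearMap.inr_apply, Prod.mk.injEq,
          map_eq_zero_iff _ m.injective_neg] at hy
        rw [← hy.2, hy.1, map_zero]
      · obtain ⟨y, hy⟩ := hx'
        rw [LinearMap.prod_apply, Function.prod_apply, LinearMap.inr_apply, Prod.mk.injEq,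
          map_eq_zero_iff _ m.injective_zero] at hy
        rw [← hy.2, hy.1, map_zero]
      · obtain ⟨y, hy⟩ := hx'
        rw [LinearMap.prod_apply, Function.prod_apply, LinearMap.inr_apply, Prod.mk.injEq,
          map_eq_zero_iff _ m.injective_pos] at hy
        rw [← hy.2, hy.1, map_zero]
  have hleft : ∀ n, ∀ x ∈ (S n).comap (LinearMap.inl ℂ L L'), x = 0 := by
    refine h.transitive.eq_zero_of_local (fun n x hx => (hTle n hx).1) ?_ ?_ ?_
    · intro n x hx y hy
      obtain ⟨y, rfl⟩ := m.exists_neg hy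
      have := hTneg n _ hx y
      rwa [LieAlgebra.Prod.bracket_apply, LinearMap.inl_apply, zero_lie] at this
    · intro n x hx y hy
      obtain ⟨y, rfl⟩ := m.exists_pos hy
      have := hTpos n _ hx y
      rwa [LieAlgebra.Prod.bracket_apply, LinearMap.inl_apply, zero_lie] at this
    · intro n h1 h2 x hx
      interval_cases n
      · obtain ⟨y, hy⟩ := hx
        rw [LinearMap.prod_apply, Function.prod_apply, LinearMap.inl_apply, Prod.mk.injEq,
          map_eq_zero_iff _ m'.injective_neg] at hy
        rw [← hy.1, hy.2, map_zero]
      · obtain ⟨y, hy⟩ := hx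
        rw [LinearMap.prod_apply, Function.prod_apply, LinearMap.inl_apply, Prod.mk.injEq,
          map_eq_zero_iff _ m'.injective_zero] at hy
        rw [← hy.1, hy.2, map_zero]
      · obtain ⟨y, hy⟩ := hx
        rw [LinearMap.prod_apply, Function.prod_apply, LinearMap.inl_apply, Prod.mk.injEq,
          map_eq_zero_iff _ m'.injective_pos] at hy
        rw [← hy.1, hy.2, map_zero]
  -- An element of the sum whose first coordinate is homogeneous is itself homogeneous: any other
  -- summand has zero first coordinate, and then zero second coordinate by `hright`.
  have hfst : ∀ n, ∀ p ∈ ⨆ n, S n, p.1 ∈ gr n → p ∈ S n := by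
    intro n p hp hp1
    obtain ⟨s, t, ht, ht0, rfl⟩ := exists_finset_sum_of_mem_iSup hp
    have hz : ∀ k ∈ insert n s, (t k).1 - (if k = n then (∑ k ∈ s, t k).1 else 0) = 0 := by
      refine eq_zero_of_iSupIndep hind (fun k _ => sub_mem (hTle k (ht k)).1 ?_) ?_
      · split_ifs with hk
        · exact hk ▸ hp1
        · exact Submodule.zero_mem _
      · rw [Finset.sum_sub_distrib, Finset.sum_ite_eq', if_pos (Finset.mem_insert_self _ _),
          sub_eq_zero, Prod.fst_sum]
        refine Finset.sum_insert_of_eq_zero_if_notMem fun hi => ?_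
        rw [ht0 n hi]
        rfl
    refine Submodule.sum_mem _ fun k hk => ?_
    by_cases hkn : k = n
    · exact hkn ▸ ht k
    · have h3 := hz k (Finset.mem_insert_of_mem hk)
      rw [if_neg hkn, sub_zero] at h3
      have h4 : (t k).2 = 0 := hright k _ (by
        rw [Submodule.mem_comap, LinearMap.inr_apply, ← h3]
        exact ht k)
      rw [show t k = 0 from Prod.ext h3 h4]
      exact Submodule.zero_mem _
  have hsnd : ∀ n, ∀ p ∈ ⨆ n, S n, p.2 ∈ gr' n → p ∈ S n := by
    intro n p hp hp1
    obtain ⟨s, t, ht, ht0, rfl⟩ := exists_finset_sum_of_mem_iSup hp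
    have hz : ∀ k ∈ insert n s, (t k).2 - (if k = n then (∑ k ∈ s, t k).2 else 0) = 0 := by
      refine eq_zero_of_iSupIndep hind' (fun k _ => sub_mem (hTle k (ht k)).2 ?_) ?_
      · split_ifs with hk
        · exact hk ▸ hp1
        · exact Submodule.zero_mem _
      · rw [Finset.sum_sub_distrib, Finset.sum_ite_eq', if_pos (Finset.mem_insert_self _ _),
          sub_eq_zero, Prod.snd_sum]
        refine Finset.sum_insert_of_eq_zero_if_notMem fun hi => ?_
        rw [ht0 n hi]
        rfl
    refine Submodule.sum_mem _ fun k hk => ?_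
    by_cases hkn : k = n
    · exact hkn ▸ ht k
    · have h3 := hz k (Finset.mem_insert_of_mem hk)
      rw [if_neg hkn, sub_zero] at h3
      have h4 : (t k).1 = 0 := hleft k _ (by
        rw [Submodule.mem_comap, LinearMap.inl_apply, ← h3]
        exact ht k)
      rw [show t k = 0 from Prod.ext h4 h3]
      exact Submodule.zero_mem _
  let G : LieSubalgebra ℂ (L × L') :=
    LieSubalgebra.lieSpan ℂ (L × L') ((am : Set (L × L')) ∪ a₀ ∪ ap)
  have hG : ∀ p ∈ G, p ∈ ⨆ n, S n := by
    intro p hp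
    induction hp using LieSubalgebra.lieSpan_induction with
    | mem p hp =>
      rcases hp with (hp | hp) | hp
      · have e : S (-1) = am := rfl
        exact Submodule.mem_iSup_of_mem (-1) (e ▸ hp)
      · exact Submodule.mem_iSup_of_mem 0 hp
      · exact Submodule.mem_iSup_of_mem 1 hp
    | zero => exact Submodule.zero_mem _
    | add p q _ _ hp hq => exact Submodule.add_mem _ hp hq
    | smul c p _ hp => exact Submodule.smul_mem _ c hp
    | lie p q hp' _ _ hq => exact lie_mem_of_lieSpan hloc.lie_mem_iSup hp' q hq
  have hsub := LieSubalgebra.subset_lieSpan (R := ℂ) (s := (am : Set (L × L')) ∪ a₀ ∪ ap)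
  let π : G →ₗ⁅ℂ⁆ L := (LieHom.fst ℂ L L').comp G.incl
  let π' : G →ₗ⁅ℂ⁆ L' := (LieHom.snd ℂ L L').comp G.incl
  -- Injectivity: a kernel element has first coordinate `0`, which belongs to degree `0`, so `hfst`
  -- places it in `S 0`, where `hright` applies. Surjectivity: the image contains the local part.
  have hπ : Function.Bijective π := by
    refine ⟨(injective_iff_map_eq_zero π).2 fun p hp => ?_, ?_⟩
    · have h1 : p.1.1 = 0 := hp
      have h2 := hfst 0 p.1 (hG _ p.2) (h1 ▸ Submodule.zero_mem _)
      have h3 : p.1.2 = 0 := hright 0 _ (by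
        rw [Submodule.mem_comap, LinearMap.inr_apply, ← h1]
        exact h2)
      exact Subtype.ext (Prod.ext h1 h3)
    · have : π.range = ⊤ := by
        rw [eq_top_iff, ← h.graded.generated, LieSubalgebra.lieSpan_le]
        rintro a ((ha | ha) | ha)
        · obtain ⟨y, rfl⟩ := m.exists_neg ha
          exact ⟨⟨(fm y, fm' y), hsub (Or.inl (Or.inl ⟨y, rfl⟩))⟩, rfl⟩
        · obtain ⟨y, rfl⟩ := m.exists_zero ha
          exact ⟨⟨(f₀ y, f₀' y), hsub (Or.inl (Or.inr ⟨y, rfl⟩))⟩, rfl⟩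
        · obtain ⟨y, rfl⟩ := m.exists_pos ha
          exact ⟨⟨(fp y, fp' y), hsub (Or.inr ⟨y, rfl⟩)⟩, rfl⟩
      exact LieHom.range_eq_top _ |>.1 this
  have hπ' : Function.Bijective π' := by
    refine ⟨(injective_iff_map_eq_zero π').2 fun p hp => ?_, ?_⟩
    · have h1 : p.1.2 = 0 := hp
      have h2 := hsnd 0 p.1 (hG _ p.2) (h1 ▸ Submodule.zero_mem _)
      have h3 : p.1.1 = 0 := hleft 0 _ (by
        rw [Submodule.mem_comap, LinearMap.inl_apply, ← h1]
        exact h2)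
      exact Subtype.ext (Prod.ext h3 h1)
    · have : π'.range = ⊤ := by
        rw [eq_top_iff, ← h'.graded.generated, LieSubalgebra.lieSpan_le]
        rintro a ((ha | ha) | ha)
        · obtain ⟨y, rfl⟩ := m'.exists_neg ha
          exact ⟨⟨(fm y, fm' y), hsub (Or.inl (Or.inl ⟨y, rfl⟩))⟩, rfl⟩
        · obtain ⟨y, rfl⟩ := m'.exists_zero ha
          exact ⟨⟨(f₀ y, f₀' y), hsub (Or.inl (Or.inr ⟨y, rfl⟩))⟩, rfl⟩
        · obtain ⟨y, rfl⟩ := m'.exists_pos ha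
          exact ⟨⟨(fp y, fp' y), hsub (Or.inr ⟨y, rfl⟩)⟩, rfl⟩
      exact LieHom.range_eq_top _ |>.1 this
  let Ψ : L ≃ₗ⁅ℂ⁆ L' := (LieEquiv.ofBijective π hπ).symm.trans (LieEquiv.ofBijective π' hπ')
  have hΨ : ∀ x, (x, Ψ x) ∈ G := by
    intro x
    obtain ⟨p, hp⟩ := hπ.2 x
    have h1 : (LieEquiv.ofBijective π hπ).symm x = p := by
      rw [← hp]
      exact LieEquiv.symm_apply_apply _ p
    have h2 : Ψ x = p.1.2 := by
      change LieEquiv.ofBijective π' hπ' ((LieEquiv.ofBijective π hπ).symm x) = _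
      rw [h1]
      rfl
    rw [h2, ← hp]
    exact p.2
  have hΨG : ∀ p ∈ G, Ψ p.1 = p.2 := by
    intro p hp
    have h1 : (⟨_, hΨ p.1⟩ : G) = ⟨p, hp⟩ := hπ.1 rfl
    exact congrArg (fun q : G => q.1.2) h1
  have hΨgr : ∀ n x, x ∈ gr n ↔ Ψ x ∈ gr' n := fun n x =>
    ⟨fun hx => (hTle n (hfst n _ (hG _ (hΨ x)) hx)).2,
      fun hx => (hTle n (hsnd n _ (hG _ (hΨ x)) hx)).1⟩
  refine ⟨Ψ, hΨgr, ?_⟩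
  have hΨm : ∀ y, Ψ (fm y) = fm' y := fun y => hΨG (fm y, fm' y) (hsub (Or.inl (Or.inl ⟨y, rfl⟩)))
  have hΨ₀ : ∀ y, Ψ (f₀ y) = f₀' y := fun y => hΨG (f₀ y, f₀' y) (hsub (Or.inl (Or.inr ⟨y, rfl⟩)))
  have hΨp : ∀ y, Ψ (fp y) = fp' y := fun y => hΨG (fp y, fp' y) (hsub (Or.inr ⟨y, rfl⟩))
  -- The pulled back form and `B` are both invariant and graded, so agreement on the local part
  -- suffices.
  let C : LinearMap.BilinForm ℂ L := B'.compl₁₂ (Ψ : L →ₗ[ℂ] L') (Ψ : L →ₗ[ℂ] L')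
  have hC : ∀ x y, C x y = B' (Ψ x) (Ψ y) := fun _ _ => rfl
  suffices H : C = B by
    intro x y
    rw [← H, hC]
  refine IsInvariantForm.eq_of_local h.graded ⟨fun x y => h'.form.symm _ _, fun x y z => ?_⟩ h.form
    (fun i j hij x hx y hy => h'.gradedForm i j hij _ ((hΨgr i x).1 hx) _ ((hΨgr j y).1 hy))
    h.gradedForm ?_
  · rw [hC, hC, LieEquiv.map_lie, LieEquiv.map_lie, h'.form.invariant]
  · intro i h1 h2 x hx y hy
    rw [hC]
    interval_cases i
    · obtain ⟨x, rfl⟩ := m.exists_neg hx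
      obtain ⟨y, rfl⟩ := m.exists_pos (by simpa using hy)
      rw [hΨm, hΨp, h'.form.symm, h.form.symm, m.form_pos_neg, m'.form_pos_neg]
    · obtain ⟨x, rfl⟩ := m.exists_zero hx
      obtain ⟨y, rfl⟩ := m.exists_zero (by simpa using hy)
      rw [hΨ₀, hΨ₀, m.form_zero, m'.form_zero]
    · obtain ⟨x, rfl⟩ := m.exists_pos hx
      obtain ⟨y, rfl⟩ := m.exists_neg hy
      rw [hΨp, hΨm, m.form_pos_neg, m'.form_pos_neg]

end IsLocalModel

end LocalModel

/-! ### Quotients and the universal property of the maximal algebra. -/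

section QuotientHom

variable {g g' : Type*} [LieRing g] [LieAlgebra ℂ g] [LieRing g'] [LieAlgebra ℂ g']

/-- The quotient map of a Lie algebra by an ideal, as a morphism of Lie algebras. -/
def LieIdeal.mkHom (I : LieIdeal ℂ g) : g →ₗ⁅ℂ⁆ g ⧸ I where
  toFun := LieSubmodule.Quotient.mk' I
  map_add' := map_add _
  map_smul' := map_smul _
  map_lie' := rfl

theorem LieIdeal.mkHom_surjective (I : LieIdeal ℂ g) : Function.Surjective I.mkHom :=
  LieSubmodule.Quotient.surjective_mk' I

theorem LieIdeal.mkHom_eq_zero {I : LieIdeal ℂ g} {x : g} : I.mkHom x = 0 ↔ x ∈ I :=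
  LieSubmodule.Quotient.mk_eq_zero I

/-- A morphism which vanishes on an ideal factors through the quotient. -/
def LieIdeal.liftHom (I : LieIdeal ℂ g) (f : g →ₗ⁅ℂ⁆ g') (h : ∀ x ∈ I, f x = 0) :
    g ⧸ I →ₗ⁅ℂ⁆ g' where
  toLinearMap := I.toSubmodule.liftQ (f : g →ₗ[ℂ] g') h
  map_lie' := by
    intro x y
    obtain ⟨x, rfl⟩ := I.mkHom_surjective x
    obtain ⟨y, rfl⟩ := I.mkHom_surjective y
    exact f.map_lie x y

theorem LieIdeal.liftHom_mkHom (I : LieIdeal ℂ g) (f : g →ₗ⁅ℂ⁆ g') (h : ∀ x ∈ I, f x = 0) (x : g) :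
    I.liftHom f h (I.mkHom x) = f x := rfl

end QuotientHom

namespace LocalLieAlgebra

variable (Γ : LocalLieAlgebra.{u})

theorem mkHom_relator {a : FreeLieAlgebra ℂ Γ.Space} (h : Γ.IsRelator a) :
    Γ.relatorIdeal.mkHom a = 0 :=
  LieIdeal.mkHom_eq_zero.2 (LieSubmodule.subset_lieSpan h)

/-- The canonical map from `Γ` to the maximal graded Lie algebra, as a linear map. -/
def toGmaxLinear : Γ.Space →ₗ[ℂ] Γ.Gmax where
  toFun := Γ.toGmax
  map_add' a b := by
    have := Γ.mkHom_relator (.add a b)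
    rw [map_sub, map_add, sub_eq_zero] at this
    exact this
  map_smul' c a := by
    have := Γ.mkHom_relator (.smul c a)
    rw [map_sub, map_smul, sub_eq_zero] at this
    exact this

/-- The component of degree `-1` of `Γ` in the maximal graded Lie algebra. -/
def gmaxNeg : Γ.neg →ₗ[ℂ] Γ.Gmax := Γ.toGmaxLinear ∘ₗ LinearMap.inl ℂ _ _

/-- The component of degree `0` of `Γ` in the maximal graded Lie algebra. -/
def gmaxZero : Γ.zero →ₗ[ℂ] Γ.Gmax :=
  Γ.toGmaxLinear ∘ₗ LinearMap.inr ℂ _ _ ∘ₗ LinearMap.inl ℂ _ _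

/-- The component of degree `1` of `Γ` in the maximal graded Lie algebra. -/
def gmaxPos : Γ.pos →ₗ[ℂ] Γ.Gmax :=
  Γ.toGmaxLinear ∘ₗ LinearMap.inr ℂ _ _ ∘ₗ LinearMap.inr ℂ _ _

theorem toGmax_neg (y : Γ.neg) : Γ.toGmax (y, 0, 0) = Γ.gmaxNeg y := rfl

theorem toGmax_zero (u : Γ.zero) : Γ.toGmax (0, u, 0) = Γ.gmaxZero u := rfl

theorem toGmax_pos (x : Γ.pos) : Γ.toGmax (0, 0, x) = Γ.gmaxPos x := rfl

theorem toGmax_eq_sum (a : Γ.Space) :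
    Γ.toGmax a = Γ.gmaxNeg a.1 + Γ.gmaxZero a.2.1 + Γ.gmaxPos a.2.2 := by
  change Γ.toGmaxLinear a = Γ.toGmaxLinear _ + Γ.toGmaxLinear _ + Γ.toGmaxLinear _
  rw [← map_add, ← map_add]
  congr 1
  ext <;> simp

theorem gmaxZero_lie_gmaxZero (u v : Γ.zero) :
    ⁅Γ.gmaxZero u, Γ.gmaxZero v⁆ = Γ.gmaxZero ⁅u, v⁆ := by
  have := Γ.mkHom_relator (.zero_zero u v)
  rw [map_sub, LieHom.map_lie, sub_eq_zero] at this
  exact this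

theorem gmaxZero_lie_gmaxPos (u : Γ.zero) (x : Γ.pos) :
    ⁅Γ.gmaxZero u, Γ.gmaxPos x⁆ = Γ.gmaxPos ⁅u, x⁆ := by
  have := Γ.mkHom_relator (.zero_pos u x)
  rw [map_sub, LieHom.map_lie, sub_eq_zero] at this
  exact this

theorem gmaxZero_lie_gmaxNeg (u : Γ.zero) (y : Γ.neg) :
    ⁅Γ.gmaxZero u, Γ.gmaxNeg y⁆ = Γ.gmaxNeg ⁅u, y⁆ := by
  have := Γ.mkHom_relator (.zero_neg u y)
  rw [map_sub, LieHom.map_lie, sub_eq_zero] at this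
  exact this

theorem gmaxPos_lie_gmaxNeg (x : Γ.pos) (y : Γ.neg) :
    ⁅Γ.gmaxPos x, Γ.gmaxNeg y⁆ = Γ.gmaxZero (Γ.bracket x y) := by
  have := Γ.mkHom_relator (.pos_neg x y)
  rw [map_sub, LieHom.map_lie, sub_eq_zero] at this
  exact this

section Lift

variable {Γ} {g : Type*} [LieRing g] [LieAlgebra ℂ g]

/-- The universal property: linear maps on the three components that respect the defined brackets
extend to the maximal algebra. Both the induced representation and the degree scaling arise in this
way. -/
theorem exists_gmaxLift (fm : Γ.neg →ₗ[ℂ] g) (f₀ : Γ.zero →ₗ[ℂ] g) (fp : Γ.pos →ₗ[ℂ] g)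
    (hzz : ∀ u v, ⁅f₀ u, f₀ v⁆ = f₀ ⁅u, v⁆) (hzp : ∀ u x, ⁅f₀ u, fp x⁆ = fp ⁅u, x⁆)
    (hzm : ∀ u y, ⁅f₀ u, fm y⁆ = fm ⁅u, y⁆) (hpm : ∀ x y, ⁅fp x, fm y⁆ = f₀ (Γ.bracket x y)) :
    ∃ F : Γ.Gmax →ₗ⁅ℂ⁆ g, (∀ y, F (Γ.gmaxNeg y) = fm y) ∧ (∀ u, F (Γ.gmaxZero u) = f₀ u) ∧
      ∀ x, F (Γ.gmaxPos x) = fp x := by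
  let f : Γ.Space →ₗ[ℂ] g := fm.coprod (f₀.coprod fp)
  let F₀ : FreeLieAlgebra ℂ Γ.Space →ₗ⁅ℂ⁆ g := FreeLieAlgebra.lift ℂ f
  have hF₀ : ∀ a, F₀ (FreeLieAlgebra.of ℂ a) = f a := fun a =>
    FreeLieAlgebra.lift_of_apply (f : Γ.Space → g) a
  have hfm : ∀ y, f (y, 0, 0) = fm y := fun y => by simp [f]
  have hf₀ : ∀ u, f (0, u, 0) = f₀ u := fun y => by simp [f]
  have hfp : ∀ x, f (0, 0, x) = fp x := fun y => by simp [f]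
  have hker : Γ.relatorIdeal ≤ F₀.ker := by
    refine LieSubmodule.lieSpan_le.2 fun a ha => ?_
    rw [SetLike.mem_coe, LieHom.mem_ker]
    cases ha with
    | add a b => simp [hF₀]
    | smul c a => simp [hF₀]
    | zero_zero u v => rw [map_sub, LieHom.map_lie]; simp only [hF₀, hf₀, hzz, sub_self]
    | zero_pos u v => rw [map_sub, LieHom.map_lie]; simp only [hF₀, hf₀, hfp, hzp, sub_self]
    | zero_neg u v => rw [map_sub, LieHom.map_lie]; simp only [hF₀, hf₀, hfm, hzm, sub_self]
    | pos_neg u v => rw [map_sub, LieHom.map_lie]; simp only [hF₀, hf₀, hfp, hfm, hpm, sub_self]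
  refine ⟨Γ.relatorIdeal.liftHom F₀ fun x hx => LieHom.mem_ker.1 (hker hx), fun y => ?_, fun u => ?_,
    fun x => ?_⟩
  · exact (hF₀ _).trans (hfm y)
  · exact (hF₀ _).trans (hf₀ u)
  · exact (hF₀ _).trans (hfp x)

end Lift

/-! ### The action on the free module over the tensor algebra -/

section InducedModule

attribute [local instance] LieRing.ofAssociativeRing

variable (M : Type u) [AddCommGroup M] [Module ℂ M]

/-- The tensor product of the tensor algebra of `Γ.pos` with `M`, in coordinates. -/
abbrev Induced : Type u := List (Fin (Module.finrank ℂ Γ.pos)) →₀ M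

/-- Left multiplication by a basis vector. -/
def inducedCons (i : Fin (Module.finrank ℂ Γ.pos)) : Module.End ℂ (Γ.Induced M) :=
  Finsupp.lmapDomain M ℂ (List.cons i)

/-- The action of `Γ.pos`: left multiplication. -/
def inducedPos : Γ.pos →ₗ[ℂ] Module.End ℂ (Γ.Induced M) :=
  (Module.finBasis ℂ Γ.pos).constr ℂ (Γ.inducedCons M)

variable {M} in
theorem inducedCons_single (i : Fin (Module.finrank ℂ Γ.pos)) (l : List _) (m : M) :
    Γ.inducedCons M i (Finsupp.single l m) = Finsupp.single (i :: l) m := by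
  simp [inducedCons, Finsupp.mapDomain_single]

variable {M} in
theorem inducedPos_basis (i : Fin (Module.finrank ℂ Γ.pos)) :
    Γ.inducedPos M (Module.finBasis ℂ Γ.pos i) = Γ.inducedCons M i := by
  simp [inducedPos]

variable {Γ M} in
@[elab_as_elim]
theorem induced_induction {p : Γ.Induced M → Prop} (hadd : ∀ w w', p w → p w' → p (w + w'))
    (hzero : p 0) (hnil : ∀ m, p (Finsupp.single [] m))
    (hpos : ∀ x w, p w → p (Γ.inducedPos M x w)) (w : Γ.Induced M) : p w := by
  induction w using Finsupp.induction_linear with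
  | zero => exact hzero
  | add w w' hw hw' => exact hadd w w' hw hw'
  | single l m =>
    induction l with
    | nil => exact hnil m
    | cons i l ih =>
      rw [← inducedCons_single, ← inducedPos_basis]
      exact hpos _ _ ih

variable [LieRingModule Γ.zero M] [LieModule ℂ Γ.zero M]

/-- The action of `Γ.zero` on the summand indexed by a list. -/
def inducedZeroAux : List (Fin (Module.finrank ℂ Γ.pos)) → Γ.zero →ₗ[ℂ] M →ₗ[ℂ] Γ.Induced M
  | [] => (LieModule.toEnd ℂ Γ.zero M : Γ.zero →ₗ[ℂ] Module.End ℂ M).compr₂ (Finsupp.lsingle [])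
  | i :: l => (Γ.inducedPos M ∘ₗ (LieModule.toEnd ℂ Γ.zero Γ.pos : Γ.zero →ₗ[ℂ]
      Module.End ℂ Γ.pos).flip (Module.finBasis ℂ Γ.pos i)).compl₂ (Finsupp.lsingle l) +
      (inducedZeroAux l).compr₂ (Γ.inducedCons M i)

/-- The action of `Γ.zero`. -/
def inducedZero : Γ.zero →ₗ[ℂ] Module.End ℂ (Γ.Induced M) :=
  (Finsupp.lsum ℂ).toLinearMap ∘ₗ LinearMap.pi (Γ.inducedZeroAux M)

/-- The action of `Γ.neg` on the summand indexed by a list. -/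
def inducedNegAux : List (Fin (Module.finrank ℂ Γ.pos)) → Γ.neg →ₗ[ℂ] M →ₗ[ℂ] Γ.Induced M
  | [] => 0
  | i :: l => (inducedNegAux l).compr₂ (Γ.inducedCons M i) -
      (Γ.inducedZero M ∘ₗ Γ.bracket (Module.finBasis ℂ Γ.pos i)).compl₂ (Finsupp.lsingle l)

/-- The action of `Γ.neg`. -/
def inducedNeg : Γ.neg →ₗ[ℂ] Module.End ℂ (Γ.Induced M) :=
  (Finsupp.lsum ℂ).toLinearMap ∘ₗ LinearMap.pi (Γ.inducedNegAux M)

variable {M}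

theorem inducedZero_single (u : Γ.zero) (l : List _) (m : M) :
    Γ.inducedZero M u (Finsupp.single l m) = Γ.inducedZeroAux M l u m := by
  simp [inducedZero]

theorem inducedNeg_single (y : Γ.neg) (l : List _) (m : M) :
    Γ.inducedNeg M y (Finsupp.single l m) = Γ.inducedNegAux M l y m := by
  simp [inducedNeg]

theorem inducedZero_single_nil (u : Γ.zero) (m : M) :
    Γ.inducedZero M u (Finsupp.single [] m) = Finsupp.single [] ⁅u, m⁆ := by
  rw [inducedZero_single]
  rfl

theorem inducedNeg_single_nil (y : Γ.neg) (m : M) :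
    Γ.inducedNeg M y (Finsupp.single [] m) = 0 := by
  rw [inducedNeg_single]
  rfl

/-- For a basis vector acting on a pure word this is the recursive definition of `inducedZeroAux`;
both sides are linear in `x` and `w`. -/
theorem inducedZero_inducedPos (u : Γ.zero) (x : Γ.pos) (w : Γ.Induced M) :
    Γ.inducedZero M u (Γ.inducedPos M x w) =
      Γ.inducedPos M ⁅u, x⁆ w + Γ.inducedPos M x (Γ.inducedZero M u w) := by
  let f : Γ.pos →ₗ[ℂ] Module.End ℂ (Γ.Induced M) :=
    (Γ.inducedPos M).compr₂ (Γ.inducedZero M u)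
  let f' : Γ.pos →ₗ[ℂ] Module.End ℂ (Γ.Induced M) :=
    Γ.inducedPos M ∘ₗ (LieModule.toEnd ℂ Γ.zero Γ.pos u) +
      (Γ.inducedPos M).compl₂ (Γ.inducedZero M u)
  suffices h : f = f' from LinearMap.congr_fun (LinearMap.congr_fun h x) w
  refine (Module.finBasis ℂ Γ.pos).ext fun i => Finsupp.lhom_ext fun l m => ?_
  change Γ.inducedZero M u (Γ.inducedPos M (Module.finBasis ℂ Γ.pos i) (Finsupp.single l m)) =
    Γ.inducedPos M ⁅u, Module.finBasis ℂ Γ.pos i⁆ (Finsupp.single l m) +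
      Γ.inducedPos M (Module.finBasis ℂ Γ.pos i) (Γ.inducedZero M u (Finsupp.single l m))
  rw [inducedPos_basis, inducedCons_single, inducedZero_single, inducedZero_single]
  rfl

theorem inducedNeg_inducedPos (y : Γ.neg) (x : Γ.pos) (w : Γ.Induced M) :
    Γ.inducedNeg M y (Γ.inducedPos M x w) =
      Γ.inducedPos M x (Γ.inducedNeg M y w) - Γ.inducedZero M (Γ.bracket x y) w := by
  let f : Γ.pos →ₗ[ℂ] Module.End ℂ (Γ.Induced M) :=
    (Γ.inducedPos M).compr₂ (Γ.inducedNeg M y)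
  let f' : Γ.pos →ₗ[ℂ] Module.End ℂ (Γ.Induced M) :=
    (Γ.inducedPos M).compl₂ (Γ.inducedNeg M y) - Γ.inducedZero M ∘ₗ Γ.bracket.flip y
  suffices h : f = f' from LinearMap.congr_fun (LinearMap.congr_fun h x) w
  refine (Module.finBasis ℂ Γ.pos).ext fun i => Finsupp.lhom_ext fun l m => ?_
  change Γ.inducedNeg M y (Γ.inducedPos M (Module.finBasis ℂ Γ.pos i) (Finsupp.single l m)) =
      Γ.inducedPos M (Module.finBasis ℂ Γ.pos i) (Γ.inducedNeg M y (Finsupp.single l m)) -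
      Γ.inducedZero M (Γ.bracket (Module.finBasis ℂ Γ.pos i) y) (Finsupp.single l m)
  rw [inducedPos_basis, inducedCons_single, inducedNeg_single, inducedNeg_single]
  rfl

/-- Induction on word length: the empty word uses that `M` is a `Γ.zero`-module, and prefixing a
letter uses that `Γ.pos` is one. -/
theorem inducedZero_lie (u v : Γ.zero) (w : Γ.Induced M) :
    Γ.inducedZero M u (Γ.inducedZero M v w) - Γ.inducedZero M v (Γ.inducedZero M u w) =
      Γ.inducedZero M ⁅u, v⁆ w := by
  refine induced_induction (fun w w' h h' => ?_) ?_ (fun m => ?_) (fun x w h => ?_) w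
  · simp only [map_add, ← h, ← h']; abel
  · simp
  · simp only [inducedZero_single_nil, lie_lie, Finsupp.single_sub]
  · simp only [inducedZero_inducedPos, map_add, ← h, lie_lie, map_sub, LinearMap.sub_apply]
    abel

theorem inducedZero_lie_inducedNeg (u : Γ.zero) (y : Γ.neg) (w : Γ.Induced M) :
    Γ.inducedZero M u (Γ.inducedNeg M y w) - Γ.inducedNeg M y (Γ.inducedZero M u w) =
      Γ.inducedNeg M ⁅u, y⁆ w := by
  refine induced_induction (fun w w' h h' => ?_) ?_ (fun m => ?_) (fun x w h => ?_) w
  · simp only [map_add, ← h, ← h']; abel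
  · simp
  · simp only [inducedZero_single_nil, inducedNeg_single_nil, map_zero, sub_zero]
  · have e := congrArg (fun z => Γ.inducedZero M z w) (Γ.jacobi u x y)
    simp only [map_add, LinearMap.add_apply, ← inducedZero_lie] at e
    simp only [inducedZero_inducedPos, inducedNeg_inducedPos, map_add, map_sub, ← h]
    rw [sub_eq_iff_eq_add] at e
    rw [e]
    abel

theorem inducedPos_lie_inducedNeg (x : Γ.pos) (y : Γ.neg) (w : Γ.Induced M) :
    Γ.inducedPos M x (Γ.inducedNeg M y w) - Γ.inducedNeg M y (Γ.inducedPos M x w) =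
      Γ.inducedZero M (Γ.bracket x y) w := by
  rw [inducedNeg_inducedPos, sub_sub_cancel]

variable (M)

/-- The maximal graded Lie algebra acts on the induced module. -/
theorem exists_inducedRep : ∃ F : Γ.Gmax →ₗ⁅ℂ⁆ Module.End ℂ (Γ.Induced M),
    (∀ y, F (Γ.gmaxNeg y) = Γ.inducedNeg M y) ∧ (∀ u, F (Γ.gmaxZero u) = Γ.inducedZero M u) ∧
      ∀ x, F (Γ.gmaxPos x) = Γ.inducedPos M x := by
  refine exists_gmaxLift _ _ _ (fun u v => ?_) (fun u x => ?_) (fun u y => ?_) (fun x y => ?_)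
  · exact LinearMap.ext fun w => Γ.inducedZero_lie u v w
  · refine LinearMap.ext fun w => ?_
    change Γ.inducedZero M u (Γ.inducedPos M x w) - Γ.inducedPos M x (Γ.inducedZero M u w) = _
    rw [inducedZero_inducedPos, add_sub_cancel_right]
  · exact LinearMap.ext fun w => Γ.inducedZero_lie_inducedNeg u y w
  · exact LinearMap.ext fun w => Γ.inducedPos_lie_inducedNeg x y w

variable {M}

/-- On the words of length zero, which form a copy of `M`, degree `0` acts as on `M`. -/
theorem gmaxZero_injective (hM : ∀ u : Γ.zero, (∀ m : M, ⁅u, m⁆ = 0) → u = 0) :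
    Function.Injective Γ.gmaxZero := by
  refine (injective_iff_map_eq_zero _).2 fun u hu => hM u fun m => ?_
  obtain ⟨F, -, hF, -⟩ := Γ.exists_inducedRep M
  have h := hF u
  rw [hu, map_zero] at h
  have h1 := LinearMap.congr_fun h (Finsupp.single [] m)
  rw [inducedZero_single_nil] at h1
  exact Finsupp.single_eq_zero.1 h1.symm

/-- Acting on `m` placed at the empty word, `x` produces its coordinates times `m` on the one-letter
words. -/
theorem gmaxPos_injective [Nontrivial M] : Function.Injective Γ.gmaxPos := by
  refine (injective_iff_map_eq_zero _).2 fun x hx => ?_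
  obtain ⟨m, hm⟩ := exists_ne (0 : M)
  obtain ⟨F, -, -, hF⟩ := Γ.exists_inducedRep M
  have h := hF x
  rw [hx, map_zero] at h
  have h1 := LinearMap.congr_fun h (Finsupp.single [] m)
  rw [← (Module.finBasis ℂ Γ.pos).sum_repr x, map_sum, LinearMap.sum_apply] at h1
  simp only [map_smul, inducedPos_basis, LinearMap.smul_apply, inducedCons_single] at h1
  refine (Module.finBasis ℂ Γ.pos).ext_elem fun i => ?_
  have h2 := DFunLike.congr_fun h1 [i]
  rw [Finsupp.finsetSum_apply, Finset.sum_eq_single i] at h2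
  · rw [map_zero]
    simp only [LinearMap.zero_apply, Finsupp.coe_zero, Pi.zero_apply, Finsupp.smul_apply,
      Finsupp.single_eq_same] at h2
    exact (smul_eq_zero.1 h2.symm).resolve_right hm
  · intro j _ hj
    rw [Finsupp.smul_apply, Finsupp.single_eq_of_ne (by simpa using hj.symm), smul_zero]
  · simp

end InducedModule

/-- `Γ.neg` annihilates the empty word, so it is detected through its brackets with `Γ.pos`, which
lie in the already embedded degree `0`. -/
theorem gmaxNeg_injective (h₀ : Function.Injective Γ.gmaxZero)
    (h : ∀ y : Γ.neg, (∀ x, Γ.bracket x y = 0) → y = 0) : Function.Injective Γ.gmaxNeg := by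
  refine (injective_iff_map_eq_zero _).2 fun y hy => h y fun x => ?_
  rw [← map_eq_zero_iff _ h₀, ← gmaxPos_lie_gmaxNeg, hy, lie_zero]

end LocalLieAlgebra

section GradedSubspaces

variable {M : Type*} [AddCommGroup M] [Module ℂ M]

/-- A graded subspace whose components of degrees in `s` vanish is disjoint from the sum of the
components of degrees in `s`. -/
theorem disjoint_of_graded {gr : ℤ → Submodule ℂ M} (hind : iSupIndep gr) {N : Submodule ℂ M}
    (hN : N ≤ ⨆ n, N ⊓ gr n) {s : Set ℤ} (h0 : ∀ n ∈ s, N ⊓ gr n = ⊥) :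
    Disjoint N (⨆ n ∈ s, gr n) := by
  have h1 : N ≤ ⨆ n ∈ sᶜ, gr n := by
    refine hN.trans (iSup_le fun n => ?_)
    by_cases hn : n ∈ s
    · rw [h0 n hn]
      exact bot_le
    · exact inf_le_right.trans (le_biSup gr (show n ∈ sᶜ from hn))
  exact (hind.disjoint_biSup_biSup disjoint_compl_left).mono_left h1

end GradedSubspaces

namespace LocalLieAlgebra

variable (Γ : LocalLieAlgebra.{u})

/-! ### The grading of the maximal graded Lie algebra -/

theorem gmaxNeg_mem (y : Γ.neg) : Γ.gmaxNeg y ∈ Γ.gmaxGrading (-1) :=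
  Submodule.subset_span (IsMonomial.neg y)

theorem gmaxZero_mem (u : Γ.zero) : Γ.gmaxZero u ∈ Γ.gmaxGrading 0 :=
  Submodule.subset_span (IsMonomial.zero u)

theorem gmaxPos_mem (x : Γ.pos) : Γ.gmaxPos x ∈ Γ.gmaxGrading 1 :=
  Submodule.subset_span (IsMonomial.pos x)

theorem gmaxGrading_lie_mem (m n : ℤ) : ∀ x ∈ Γ.gmaxGrading m, ∀ y ∈ Γ.gmaxGrading n,
    ⁅x, y⁆ ∈ Γ.gmaxGrading (m + n) := by
  intro x hx y hy
  induction hx using Submodule.span_induction with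
  | mem a ha =>
    induction hy using Submodule.span_induction with
    | mem b hb => exact Submodule.subset_span (ha.lie hb)
    | zero => rw [lie_zero]; exact zero_mem _
    | add y z _ _ hy hz => rw [lie_add]; exact add_mem hy hz
    | smul c y _ hy => rw [lie_smul]; exact Submodule.smul_mem _ c hy
  | zero => rw [zero_lie]; exact zero_mem _
  | add x z _ _ hx hz => rw [add_lie]; exact add_mem hx hz
  | smul c x _ hx => rw [smul_lie]; exact Submodule.smul_mem _ c hx

theorem gmax_lieSpan : LieSubalgebra.lieSpan ℂ Γ.Gmax
    ((LinearMap.range Γ.gmaxNeg : Set Γ.Gmax) ∪ LinearMap.range Γ.gmaxZero ∪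
      LinearMap.range Γ.gmaxPos) = ⊤ := by
  set K := LieSubalgebra.lieSpan ℂ Γ.Gmax ((LinearMap.range Γ.gmaxNeg : Set Γ.Gmax) ∪
    LinearMap.range Γ.gmaxZero ∪ LinearMap.range Γ.gmaxPos) with hK
  have hsub := LieSubalgebra.subset_lieSpan (R := ℂ) (s := (LinearMap.range Γ.gmaxNeg : Set Γ.Gmax) ∪
    LinearMap.range Γ.gmaxZero ∪ LinearMap.range Γ.gmaxPos)
  rw [← hK] at hsub
  have hmem : ∀ a, Γ.toGmax a ∈ K := by
    intro a
    rw [toGmax_eq_sum]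
    exact add_mem (add_mem (hsub (Or.inl (Or.inl ⟨_, rfl⟩))) (hsub (Or.inl (Or.inr ⟨_, rfl⟩))))
      (hsub (Or.inr ⟨_, rfl⟩))
  -- The quotient map from the free Lie algebra factors through `K`, since both maps agree on
  -- generators; as it is surjective, `K` is everything.
  let F : FreeLieAlgebra ℂ Γ.Space →ₗ⁅ℂ⁆ K := FreeLieAlgebra.lift ℂ fun a => ⟨Γ.toGmax a, hmem a⟩
  have hF : K.incl.comp F = Γ.relatorIdeal.mkHom := by
    refine FreeLieAlgebra.hom_ext fun a => ?_
    rw [LieHom.comp_apply, FreeLieAlgebra.lift_of_apply]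
    rfl
  rw [eq_top_iff]
  intro x _
  obtain ⟨f, rfl⟩ := Γ.relatorIdeal.mkHom_surjective x
  rw [← hF]
  exact (F f).2

/-- The relations are homogeneous, so degrees can be rescaled; in the bracket of degrees `1` and
`-1` the factors `2` and `2⁻¹` cancel. -/
theorem exists_gmaxScale : ∃ φ : Γ.Gmax →ₗ⁅ℂ⁆ Γ.Gmax,
    ∀ n, ∀ x ∈ Γ.gmaxGrading n, φ x = (2 : ℂ) ^ n • x := by
  obtain ⟨φ, hm, h0, hp⟩ := exists_gmaxLift ((2 : ℂ)⁻¹ • Γ.gmaxNeg) Γ.gmaxZero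
    ((2 : ℂ) • Γ.gmaxPos) Γ.gmaxZero_lie_gmaxZero
    (fun u x => by
      rw [LinearMap.smul_apply, lie_smul, gmaxZero_lie_gmaxPos, LinearMap.smul_apply])
    (fun u x => by
      rw [LinearMap.smul_apply, lie_smul, gmaxZero_lie_gmaxNeg, LinearMap.smul_apply])
    (fun x y => by
      rw [LinearMap.smul_apply, LinearMap.smul_apply, lie_smul, smul_lie, gmaxPos_lie_gmaxNeg,
        smul_smul, inv_mul_cancel₀ two_ne_zero, one_smul])
  refine ⟨φ, fun n x hx => ?_⟩
  induction hx using Submodule.span_induction with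
  | mem a ha =>
    induction ha with
    | neg y => rw [toGmax_neg, hm, zpow_neg_one]; rfl
    | zero u => rw [toGmax_zero, h0, zpow_zero, one_smul]
    | pos x => rw [toGmax_pos, hp, zpow_one]; rfl
    | lie _ _ ha hb =>
      rw [LieHom.map_lie, ha, hb, smul_lie, lie_smul, smul_smul, zpow_add₀ two_ne_zero]
  | zero => simp
  | add x y _ _ hx hy => rw [map_add, hx, hy, smul_add]
  | smul c x _ hx => rw [map_smul, hx, smul_comm]

/-- The components lie in eigenspaces for the eigenvalues `2^n`, which are distinct because their
absolute values are. -/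
theorem iSupIndep_of_scale {M : Type*} [AddCommGroup M] [Module ℂ M] {gr : ℤ → Submodule ℂ M}
    (φ : Module.End ℂ M) (h : ∀ n, ∀ x ∈ gr n, φ x = (2 : ℂ) ^ n • x) : iSupIndep gr := by
  have hinj : Function.Injective fun n : ℤ => (2 : ℂ) ^ n := by
    intro m n hmn
    have := congrArg (fun z : ℂ => ‖z‖) hmn
    simp only [norm_zpow, Complex.norm_ofNat] at this
    exact zpow_right_injective₀ (by norm_num) (by norm_num) this
  exact (φ.eigenspaces_iSupIndep.comp hinj).mono fun n x hx =>
    Module.End.mem_eigenspace_iff.2 (h n x hx)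

theorem gmax_iSupIndep : iSupIndep Γ.gmaxGrading := by
  obtain ⟨φ, hφ⟩ := Γ.exists_gmaxScale
  exact iSupIndep_of_scale (φ : Γ.Gmax →ₗ[ℂ] Γ.Gmax) hφ

theorem gmax_isLocalAction : IsLocalAction (LinearMap.range Γ.gmaxNeg) (LinearMap.range Γ.gmaxZero)
    (LinearMap.range Γ.gmaxPos) (LinearMap.range Γ.gmaxNeg) (LinearMap.range Γ.gmaxZero)
    (LinearMap.range Γ.gmaxPos) := by
  have zz : ∀ a ∈ LinearMap.range Γ.gmaxZero, ∀ b ∈ LinearMap.range Γ.gmaxZero,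
      ⁅a, b⁆ ∈ LinearMap.range Γ.gmaxZero := by
    rintro _ ⟨u, rfl⟩ _ ⟨v, rfl⟩
    exact ⟨⁅u, v⁆, (Γ.gmaxZero_lie_gmaxZero u v).symm⟩
  have zm : ∀ a ∈ LinearMap.range Γ.gmaxZero, ∀ b ∈ LinearMap.range Γ.gmaxNeg,
      ⁅a, b⁆ ∈ LinearMap.range Γ.gmaxNeg := by
    rintro _ ⟨u, rfl⟩ _ ⟨v, rfl⟩
    exact ⟨⁅u, v⁆, (Γ.gmaxZero_lie_gmaxNeg u v).symm⟩
  have zp : ∀ a ∈ LinearMap.range Γ.gmaxZero, ∀ b ∈ LinearMap.range Γ.gmaxPos,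
      ⁅a, b⁆ ∈ LinearMap.range Γ.gmaxPos := by
    rintro _ ⟨u, rfl⟩ _ ⟨v, rfl⟩
    exact ⟨⁅u, v⁆, (Γ.gmaxZero_lie_gmaxPos u v).symm⟩
  have pm : ∀ a ∈ LinearMap.range Γ.gmaxPos, ∀ b ∈ LinearMap.range Γ.gmaxNeg,
      ⁅a, b⁆ ∈ LinearMap.range Γ.gmaxZero := by
    rintro _ ⟨x, rfl⟩ _ ⟨y, rfl⟩
    exact ⟨Γ.bracket x y, (Γ.gmaxPos_lie_gmaxNeg x y).symm⟩
  exact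
  { zero_neg := zm
    zero_pos := zp
    neg_pos := lie_mem_comm pm
    zero_Dm := zm
    zero_D₀ := zz
    zero_Dp := zp
    pos_D₀ := lie_mem_comm zp
    neg_D₀ := lie_mem_comm zm
    pos_Dm := pm
    neg_Dp := lie_mem_comm pm }

/-- The subspace spanned by the iterated brackets of elements of `Γ.pos` or of `Γ.neg`. -/
def gmaxTower : ℤ → Submodule ℂ Γ.Gmax :=
  localTower (LinearMap.range Γ.gmaxNeg) (LinearMap.range Γ.gmaxPos) (LinearMap.range Γ.gmaxNeg)
    (LinearMap.range Γ.gmaxZero) (LinearMap.range Γ.gmaxPos)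

theorem gmaxTower_neg : Γ.gmaxTower (-1) = LinearMap.range Γ.gmaxNeg := rfl

theorem gmaxTower_le : ∀ n, Γ.gmaxTower n ≤ Γ.gmaxGrading n := by
  refine localTower_le ?_ ?_ ?_ ?_ ?_
  · rintro _ ⟨y, rfl⟩ n m hm
    have := Γ.gmaxGrading_lie_mem (-1) n _ (Γ.gmaxNeg_mem y) m hm
    rwa [neg_add_eq_sub] at this
  · rintro _ ⟨x, rfl⟩ n m hm
    have := Γ.gmaxGrading_lie_mem 1 n _ (Γ.gmaxPos_mem x) m hm
    rwa [add_comm 1 n] at this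
  · rintro _ ⟨y, rfl⟩
    exact Γ.gmaxNeg_mem y
  · rintro _ ⟨y, rfl⟩
    exact Γ.gmaxZero_mem y
  · rintro _ ⟨y, rfl⟩
    exact Γ.gmaxPos_mem y

theorem iSup_gmaxTower : ⨆ n, Γ.gmaxTower n = ⊤ := by
  rw [eq_top_iff]
  intro x _
  refine mem_of_lieSpan_eq_top Γ.gmax_lieSpan ?_ (fun x => lie_mem_of_lieSpan
    Γ.gmax_isLocalAction.lie_mem_iSup (Γ.gmax_lieSpan ▸ LieSubalgebra.mem_top x)) x
  rintro a ((ha | ha) | ha)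
  · exact Submodule.mem_iSup_of_mem (p := Γ.gmaxTower) (-1) (Γ.gmaxTower_neg ▸ ha)
  · exact Submodule.mem_iSup_of_mem (p := Γ.gmaxTower) 0 ha
  · exact Submodule.mem_iSup_of_mem (p := Γ.gmaxTower) 1 ha

/-- Mixed monomials contribute nothing beyond iterated brackets of one sign. Hence degrees `-1, 0,
1` contain only the image of `Γ`, and every component is finitely generated. -/
theorem gmaxTower_eq (n : ℤ) : Γ.gmaxTower n = Γ.gmaxGrading n :=
  iSupIndep_eq_of_le Γ.gmax_iSupIndep Γ.gmaxTower_le Γ.iSup_gmaxTower n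

theorem range_gmaxNeg : LinearMap.range Γ.gmaxNeg = Γ.gmaxGrading (-1) :=
  Γ.gmaxTower_neg.symm.trans (Γ.gmaxTower_eq (-1))

theorem range_gmaxZero : LinearMap.range Γ.gmaxZero = Γ.gmaxGrading 0 := Γ.gmaxTower_eq 0

theorem range_gmaxPos : LinearMap.range Γ.gmaxPos = Γ.gmaxGrading 1 := Γ.gmaxTower_eq 1

theorem iSup_gmaxGrading : ⨆ n, Γ.gmaxGrading n = ⊤ := by
  simp only [← gmaxTower_eq, iSup_gmaxTower]

theorem gmaxGrading_fg (n : ℤ) : (Γ.gmaxGrading n).FG := by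
  rw [← gmaxTower_eq]
  have hfg : ∀ {E : Type u} [AddCommGroup E] [Module ℂ E] [FiniteDimensional ℂ E]
      (f : E →ₗ[ℂ] Γ.Gmax), (LinearMap.range f).FG := fun f => by
    rw [LinearMap.range_eq_map]
    exact Module.Finite.fg_top.map f
  exact localTower_fg (hfg _) (hfg _) (hfg _) (hfg _) (hfg _) n

/-! ### The grading of the minimal graded Lie algebra -/

theorem gmaxLocalPart_eq : Γ.gmaxLocalPart = ⨆ n ∈ Set.Icc (-1 : ℤ) 1, Γ.gmaxGrading n := by
  refine le_antisymm (sup_le (sup_le ?_ ?_) ?_) (iSup₂_le fun n hn => ?_)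
  · exact le_biSup Γ.gmaxGrading (show (-1 : ℤ) ∈ Set.Icc (-1 : ℤ) 1 by simp)
  · exact le_biSup Γ.gmaxGrading (show (0 : ℤ) ∈ Set.Icc (-1 : ℤ) 1 by simp)
  · exact le_biSup Γ.gmaxGrading (show (1 : ℤ) ∈ Set.Icc (-1 : ℤ) 1 by simp)
  · obtain ⟨h1, h2⟩ := hn
    interval_cases n
    · exact le_sup_left.trans le_sup_left
    · exact le_sup_right.trans le_sup_left
    · exact le_sup_right

theorem isAdmissibleIdeal_of_local {J : LieIdeal ℂ Γ.Gmax}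
    (hJ : J.toSubmodule ≤ ⨆ n : ℤ, J.toSubmodule ⊓ Γ.gmaxGrading n)
    (h0 : ∀ n ∈ Set.Icc (-1 : ℤ) 1, J.toSubmodule ⊓ Γ.gmaxGrading n = ⊥) :
    Γ.IsAdmissibleIdeal J :=
  ⟨hJ, (Γ.gmaxLocalPart_eq ▸ disjoint_of_graded Γ.gmax_iSupIndep hJ h0).eq_bot⟩

variable {Γ} in
theorem IsAdmissibleIdeal.le_Jmax {J : LieIdeal ℂ Γ.Gmax} (hJ : Γ.IsAdmissibleIdeal J) :
    J ≤ Γ.Jmax := le_sSup hJ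

theorem Jmax_graded : Γ.Jmax.toSubmodule ≤ ⨆ n : ℤ, Γ.Jmax.toSubmodule ⊓ Γ.gmaxGrading n := by
  conv_lhs => rw [Jmax, LieSubmodule.sSup_toSubmodule_eq_iSup]
  refine iSup₂_le fun J hJ => hJ.graded.trans (iSup_mono fun n => inf_le_inf_right _ ?_)
  exact hJ.le_Jmax

/-- Trivial intersection with a subspace is not inherited by sums in general. For graded ideals it
means lying in the components outside degrees `-1, 0, 1`, and that condition is inherited. -/
theorem Jmax_disjoint : Disjoint Γ.Jmax.toSubmodule (⨆ n ∈ Set.Icc (-1 : ℤ) 1, Γ.gmaxGrading n) := by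
  have h1 : Γ.Jmax.toSubmodule ≤ ⨆ n ∈ (Set.Icc (-1 : ℤ) 1)ᶜ, Γ.gmaxGrading n := by
    rw [Jmax, LieSubmodule.sSup_toSubmodule_eq_iSup]
    refine iSup₂_le fun J hJ => hJ.graded.trans (iSup_le fun n => ?_)
    by_cases hn : n ∈ Set.Icc (-1 : ℤ) 1
    · have : J.toSubmodule ⊓ Γ.gmaxGrading n ≤ ⊥ := by
        rw [← hJ.disjoint, gmaxLocalPart_eq]
        exact inf_le_inf_left _ (le_biSup Γ.gmaxGrading hn)
      exact this.trans bot_le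
    · exact inf_le_right.trans (le_biSup Γ.gmaxGrading (show n ∈ (Set.Icc (-1 : ℤ) 1)ᶜ from hn))
  exact (Γ.gmax_iSupIndep.disjoint_biSup_biSup disjoint_compl_left).mono_left h1

theorem eq_zero_of_mem_Jmax {n : ℤ} (hn : n ∈ Set.Icc (-1 : ℤ) 1) {x : Γ.Gmax} (hx : x ∈ Γ.Jmax)
    (hxn : x ∈ Γ.gmaxGrading n) : x = 0 :=
  Submodule.disjoint_def.1 Γ.Jmax_disjoint x hx
    ((le_biSup Γ.gmaxGrading hn : Γ.gmaxGrading n ≤ _) hxn)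

theorem gminGrading_eq (n : ℤ) : Γ.gminGrading n =
    (Γ.gmaxGrading n).map (Γ.Jmax.mkHom : Γ.Gmax →ₗ[ℂ] Γ.Gmin) := rfl

theorem mkHom_mem_gminGrading {n : ℤ} {x : Γ.Gmax} (hx : x ∈ Γ.gmaxGrading n) :
    Γ.Jmax.mkHom x ∈ Γ.gminGrading n := ⟨x, hx, rfl⟩

theorem exists_mkHom_eq {n : ℤ} {z : Γ.Gmin} (hz : z ∈ Γ.gminGrading n) :
    ∃ x ∈ Γ.gmaxGrading n, Γ.Jmax.mkHom x = z := hz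

theorem iSup_gminGrading : ⨆ n, Γ.gminGrading n = ⊤ := by
  simp only [gminGrading_eq, ← Submodule.map_iSup, iSup_gmaxGrading, Submodule.map_top]
  exact LinearMap.range_eq_top.2 Γ.Jmax.mkHom_surjective

/-- Since `Jmax` is graded, the scaling endomorphism preserves it and descends to the quotient. -/
theorem gmin_iSupIndep : iSupIndep Γ.gminGrading := by
  obtain ⟨φ, hφ⟩ := Γ.exists_gmaxScale
  have hJ : ∀ x ∈ Γ.Jmax, Γ.Jmax.mkHom.comp φ x = 0 := by
    suffices h : Γ.Jmax.toSubmodule ≤ Γ.Jmax.toSubmodule.comap (φ : Γ.Gmax →ₗ[ℂ] Γ.Gmax) from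
      fun x hx => LieIdeal.mkHom_eq_zero.2 (h hx)
    refine Γ.Jmax_graded.trans (iSup_le fun n x hx => ?_)
    rw [Submodule.mem_comap]
    exact (hφ n x hx.2).symm ▸ Submodule.smul_mem _ _ hx.1
  refine iSupIndep_of_scale (Γ.Jmax.liftHom (Γ.Jmax.mkHom.comp φ) hJ : Γ.Gmin →ₗ[ℂ] Γ.Gmin) ?_
  intro n z hz
  obtain ⟨x, hx, rfl⟩ := Γ.exists_mkHom_eq hz
  rw [LieHom.coe_toLinearMap, LieIdeal.liftHom_mkHom, LieHom.comp_apply, hφ n x hx, map_smul]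

/-- The component of degree `-1` of `Γ` in the minimal graded Lie algebra. -/
def gminNeg : Γ.neg →ₗ[ℂ] Γ.Gmin := (Γ.Jmax.mkHom : Γ.Gmax →ₗ[ℂ] Γ.Gmin) ∘ₗ Γ.gmaxNeg

/-- The component of degree `0` of `Γ` in the minimal graded Lie algebra. -/
def gminZero : Γ.zero →ₗ[ℂ] Γ.Gmin := (Γ.Jmax.mkHom : Γ.Gmax →ₗ[ℂ] Γ.Gmin) ∘ₗ Γ.gmaxZero

/-- The component of degree `1` of `Γ` in the minimal graded Lie algebra. -/
def gminPos : Γ.pos →ₗ[ℂ] Γ.Gmin := (Γ.Jmax.mkHom : Γ.Gmax →ₗ[ℂ] Γ.Gmin) ∘ₗ Γ.gmaxPos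

theorem toGmin_eq_sum (a : Γ.Space) :
    Γ.toGmin a = Γ.gminNeg a.1 + Γ.gminZero a.2.1 + Γ.gminPos a.2.2 := by
  change Γ.Jmax.mkHom (Γ.toGmax a) = _
  rw [toGmax_eq_sum, map_add, map_add]
  rfl

theorem range_gminNeg : LinearMap.range Γ.gminNeg = Γ.gminGrading (-1) := by
  rw [gminNeg, LinearMap.range_comp, range_gmaxNeg]
  rfl

theorem range_gminZero : LinearMap.range Γ.gminZero = Γ.gminGrading 0 := by
  rw [gminZero, LinearMap.range_comp, range_gmaxZero]
  rfl

theorem range_gminPos : LinearMap.range Γ.gminPos = Γ.gminGrading 1 := by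
  rw [gminPos, LinearMap.range_comp, range_gmaxPos]
  rfl

theorem gminNeg_injective (h : Function.Injective Γ.gmaxNeg) : Function.Injective Γ.gminNeg := by
  refine (injective_iff_map_eq_zero _).2 fun y hy => (map_eq_zero_iff _ h).1 ?_
  exact Γ.eq_zero_of_mem_Jmax (n := -1) (by simp) (LieIdeal.mkHom_eq_zero.1 hy) (Γ.gmaxNeg_mem y)

theorem gminZero_injective (h : Function.Injective Γ.gmaxZero) :
    Function.Injective Γ.gminZero := by
  refine (injective_iff_map_eq_zero _).2 fun y hy => (map_eq_zero_iff _ h).1 ?_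
  exact Γ.eq_zero_of_mem_Jmax (n := 0) (by simp) (LieIdeal.mkHom_eq_zero.1 hy) (Γ.gmaxZero_mem y)

theorem gminPos_injective (h : Function.Injective Γ.gmaxPos) : Function.Injective Γ.gminPos := by
  refine (injective_iff_map_eq_zero _).2 fun y hy => (map_eq_zero_iff _ h).1 ?_
  exact Γ.eq_zero_of_mem_Jmax (n := 1) (by simp) (LieIdeal.mkHom_eq_zero.1 hy) (Γ.gmaxPos_mem y)

theorem gminZero_lie_gminZero (u v : Γ.zero) :
    ⁅Γ.gminZero u, Γ.gminZero v⁆ = Γ.gminZero ⁅u, v⁆ := by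
  simp only [gminZero, LinearMap.comp_apply, ← gmaxZero_lie_gmaxZero]
  exact (LieHom.map_lie _ _ _).symm

theorem gminZero_lie_gminPos (u : Γ.zero) (x : Γ.pos) :
    ⁅Γ.gminZero u, Γ.gminPos x⁆ = Γ.gminPos ⁅u, x⁆ := by
  simp only [gminZero, gminPos, LinearMap.comp_apply, ← gmaxZero_lie_gmaxPos]
  exact (LieHom.map_lie _ _ _).symm

theorem gminZero_lie_gminNeg (u : Γ.zero) (y : Γ.neg) :
    ⁅Γ.gminZero u, Γ.gminNeg y⁆ = Γ.gminNeg ⁅u, y⁆ := by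
  simp only [gminZero, gminNeg, LinearMap.comp_apply, ← gmaxZero_lie_gmaxNeg]
  exact (LieHom.map_lie _ _ _).symm

theorem gminPos_lie_gminNeg (x : Γ.pos) (y : Γ.neg) :
    ⁅Γ.gminPos x, Γ.gminNeg y⁆ = Γ.gminZero (Γ.bracket x y) := by
  simp only [gminZero, gminPos, gminNeg, LinearMap.comp_apply, ← gmaxPos_lie_gmaxNeg]
  exact (LieHom.map_lie _ _ _).symm

theorem gmin_isGradedLieAlgebra : IsGradedLieAlgebra Γ.gminGrading where
  isInternal := DirectSum.isInternal_submodule_of_iSupIndep_of_iSup_eq_top Γ.gmin_iSupIndep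
    Γ.iSup_gminGrading
  finiteDimensional n := Module.Finite.iff_fg.2 ((Γ.gmaxGrading_fg n).map _)
  lie_mem i j z hz w hw := by
    obtain ⟨x, hx, rfl⟩ := Γ.exists_mkHom_eq hz
    obtain ⟨y, hy, rfl⟩ := Γ.exists_mkHom_eq hw
    exact ⟨⁅x, y⁆, Γ.gmaxGrading_lie_mem i j x hx y hy, LieHom.map_lie Γ.Jmax.mkHom x y⟩
  generated := by
    have h := LieSubalgebra.map_lieSpan (R := ℂ) (f := Γ.Jmax.mkHom)
      (s := (LinearMap.range Γ.gmaxNeg : Set Γ.Gmax) ∪ LinearMap.range Γ.gmaxZero ∪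
        LinearMap.range Γ.gmaxPos)
    rw [gmax_lieSpan, Set.image_union, Set.image_union, range_gmaxNeg, range_gmaxZero,
      range_gmaxPos] at h
    refine (Eq.trans ?_ h.symm).trans ?_
    · rfl
    · rw [eq_top_iff]
      intro z _
      obtain ⟨x, rfl⟩ := Γ.Jmax.mkHom_surjective z
      exact ⟨x, LieSubalgebra.mem_top x, rfl⟩

/-! ### Minimality -/

/-- A graded ideal of the minimal graded Lie algebra which meets the local part trivially is
zero. -/
theorem gmin_eq_zero_of_mem_ideal {I : LieIdeal ℂ Γ.Gmin}
    (hI : I.toSubmodule ≤ ⨆ n : ℤ, I.toSubmodule ⊓ Γ.gminGrading n)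
    (h0 : ∀ n ∈ Set.Icc (-1 : ℤ) 1, I.toSubmodule ⊓ Γ.gminGrading n = ⊥) {z : Γ.Gmin}
    (hz : z ∈ I) : z = 0 := by
  -- The preimage in the maximal algebra is admissible: it is graded because both the ideal and
  -- `Jmax` are. Hence it lies in `Jmax`.
  let J : LieIdeal ℂ Γ.Gmax := I.comap Γ.Jmax.mkHom
  have hJ : ∀ x, x ∈ J ↔ Γ.Jmax.mkHom x ∈ I := fun x => LieIdeal.mem_comap
  have hadm : Γ.IsAdmissibleIdeal J := by
    refine Γ.isAdmissibleIdeal_of_local ?_ fun n hn => ?_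
    · have h1 : I.toSubmodule ≤ (⨆ n : ℤ, J.toSubmodule ⊓ Γ.gmaxGrading n).map
          (Γ.Jmax.mkHom : Γ.Gmax →ₗ[ℂ] Γ.Gmin) := by
        refine hI.trans (iSup_le fun n z hz => ?_)
        obtain ⟨x, hx, rfl⟩ := Γ.exists_mkHom_eq hz.2
        exact ⟨x, Submodule.mem_iSup_of_mem n ⟨(hJ x).2 hz.1, hx⟩, rfl⟩
      intro x hx
      obtain ⟨y, hy, hxy⟩ := h1 ((hJ x).1 hx)
      have h2 : x - y ∈ Γ.Jmax := by
        rw [← LieIdeal.mkHom_eq_zero, map_sub, sub_eq_zero]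
        exact hxy.symm
      have h3 : Γ.Jmax.toSubmodule ≤ J.toSubmodule := fun w hw => (hJ w).2 (by
        rw [LieIdeal.mkHom_eq_zero.2 hw]
        exact zero_mem _)
      have h4 : x - y ∈ ⨆ n : ℤ, J.toSubmodule ⊓ Γ.gmaxGrading n :=
        (Γ.Jmax_graded.trans (iSup_mono fun n => inf_le_inf_right _ h3)) h2
      have := add_mem h4 hy
      rwa [sub_add_cancel] at this
    · rw [eq_bot_iff]
      intro x hx
      have h1 : Γ.Jmax.mkHom x ∈ I.toSubmodule ⊓ Γ.gminGrading n :=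
        ⟨(hJ x).1 hx.1, Γ.mkHom_mem_gminGrading hx.2⟩
      rw [h0 n hn, Submodule.mem_bot, LieIdeal.mkHom_eq_zero] at h1
      exact Γ.eq_zero_of_mem_Jmax hn h1 hx.2
  obtain ⟨x, rfl⟩ := Γ.Jmax.mkHom_surjective z
  exact LieIdeal.mkHom_eq_zero.2 (hadm.le_Jmax ((hJ x).2 hz))

/-- Transitivity of the minimal graded Lie algebra outside of the local part. -/
theorem gmin_eq_zero_of_lie_eq_zero {ε n : ℤ} (hε : ε = 1 ∨ ε = -1) (hn : 2 ≤ ε * n) {z : Γ.Gmin}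
    (hz : z ∈ Γ.gminGrading n) (h : ∀ y ∈ Γ.gminGrading (-ε), ⁅z, y⁆ = 0) : z = 0 := by
  have hgr := Γ.gmin_isGradedLieAlgebra
  -- All violations of transitivity in degree `n`. The sign `ε` points away from degree `0`, so
  -- raising `D` repeatedly by degree `ε` gives a subspace stable under the local part, hence an
  -- ideal, in the degrees `n + ε * k`.
  let D : Submodule ℂ Γ.Gmin :=
    { carrier := {w | w ∈ Γ.gminGrading n ∧ ∀ y ∈ Γ.gminGrading (-ε), ⁅y, w⁆ = 0}
      add_mem' := fun ha hb => ⟨add_mem ha.1 hb.1, fun y hy => by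
        rw [lie_add, ha.2 y hy, hb.2 y hy, add_zero]⟩
      zero_mem' := ⟨zero_mem _, fun y _ => lie_zero y⟩
      smul_mem' := fun c a ha => ⟨Submodule.smul_mem _ c ha.1, fun y hy => by
        rw [lie_smul, ha.2 y hy, smul_zero]⟩ }
  have hDn : ∀ w ∈ D, w ∈ Γ.gminGrading n := fun w hw => hw.1
  have hDy : ∀ y ∈ Γ.gminGrading (-ε), ∀ w ∈ D, ⁅y, w⁆ = 0 := fun y hy w hw => hw.2 y hy
  let S : ℕ → Submodule ℂ Γ.Gmin := lieTower (Γ.gminGrading ε) D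
  have hSle : ∀ k : ℕ, S k ≤ Γ.gminGrading (n + ε * k) := by
    intro k
    induction k with
    | zero =>
      intro w hw
      simpa using hDn w hw
    | succ k ih =>
      refine lieTower_succ_le.2 fun x hx m hm => ?_
      have := hgr.lie_mem _ _ x hx m (ih hm)
      rwa [show ε + (n + ε * k) = n + ε * ((k + 1 : ℕ) : ℤ) by push_cast; ring] at this
  have h0 : ∀ u ∈ Γ.gminGrading 0, ∀ d ∈ D, ⁅u, d⁆ ∈ D := by
    intro u hu d hd
    refine ⟨?_, fun y hy => ?_⟩
    · have := hgr.lie_mem 0 n u hu d (hDn d hd)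
      rwa [zero_add] at this
    · have h1 := hgr.lie_mem (-ε) 0 y hy u hu
      rw [add_zero] at h1
      rw [leibniz_lie, hDy _ h1 d hd, hDy y hy d hd, lie_zero, add_zero]
  have h0ε : ∀ u ∈ Γ.gminGrading 0, ∀ x ∈ Γ.gminGrading ε, ⁅u, x⁆ ∈ Γ.gminGrading ε := by
    intro u hu x hx
    have := hgr.lie_mem 0 ε u hu x hx
    rwa [zero_add] at this
  have hεε : ∀ y ∈ Γ.gminGrading (-ε), ∀ x ∈ Γ.gminGrading ε, ⁅y, x⁆ ∈ Γ.gminGrading 0 := by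
    intro y hy x hx
    have := hgr.lie_mem (-ε) ε y hy x hx
    rwa [neg_add_cancel] at this
  let W := ⨆ k, S k
  have hWlocal : ∀ a : Γ.Gmin, (∀ k, ∀ m ∈ S k, ⁅a, m⁆ ∈ W) → ∀ m ∈ W, ⁅a, m⁆ ∈ W := by
    intro a ha
    have : W ≤ W.comap (LieModule.toEnd ℂ Γ.Gmin Γ.Gmin a) := iSup_le fun k m hm => ha k m hm
    exact fun m hm => this hm
  have hWε : ∀ a ∈ Γ.gminGrading ε, ∀ m ∈ W, ⁅a, m⁆ ∈ W := fun a ha => hWlocal a fun k m hm =>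
    Submodule.mem_iSup_of_mem (k + 1) (lie_mem_lieTower_succ ha hm)
  have hW0 : ∀ a ∈ Γ.gminGrading 0, ∀ m ∈ W, ⁅a, m⁆ ∈ W := fun a ha => hWlocal a fun k m hm =>
    Submodule.mem_iSup_of_mem k (lieTower_stable h0ε h0 ha k m hm)
  have hWε' : ∀ a ∈ Γ.gminGrading (-ε), ∀ m ∈ W, ⁅a, m⁆ ∈ W := fun a ha =>
    hWlocal a fun k m hm => by
      cases k with
      | zero => rw [hDy a ha m hm]; exact zero_mem _
      | succ k =>
        refine Submodule.mem_iSup_of_mem k (lieTower_lower h0ε h0 hεε ?_ ha k m hm)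
        intro x _ y hy d hd
        rw [hDy y hy d hd, lie_zero]
        exact zero_mem _
  have hW : ∀ a : Γ.Gmin, ∀ m ∈ W, ⁅a, m⁆ ∈ W := by
    intro a
    refine lie_mem_of_lieSpan (s := (Γ.gminGrading (-1) : Set Γ.Gmin) ∪ Γ.gminGrading 0 ∪
      Γ.gminGrading 1) ?_ (hgr.generated ▸ LieSubalgebra.mem_top a)
    rcases hε with rfl | rfl
    · rintro a ((ha | ha) | ha)
      · exact hWε' a ha
      · exact hW0 a ha
      · exact hWε a ha
    · rintro a ((ha | ha) | ha)
      · exact hWε a ha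
      · exact hW0 a ha
      · exact hWε' a ha
  let I : LieIdeal ℂ Γ.Gmin := { W with lie_mem := fun {a m} hm => hW a m hm }
  have hzW : z ∈ W := Submodule.mem_iSup_of_mem 0 (show z ∈ D from ⟨hz, fun y hy => by
    rw [← lie_skew, h y hy, neg_zero]⟩)
  -- The ideal never reaches the local degrees, so maximality of `Jmax` forces it to vanish.
  have hnk : ∀ k : ℕ, n + ε * k ∉ Set.Icc (-1 : ℤ) 1 := by
    rintro k ⟨h1, h2⟩
    rcases hε with rfl | rfl <;> omega
  refine Γ.gmin_eq_zero_of_mem_ideal (I := I) ?_ (fun j hj => ?_) hzW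
  · exact iSup_le fun k => le_iSup_of_le (n + ε * k) (le_inf (le_iSup S k) (hSle k))
  · have h1 : W ≤ ⨆ j ∈ (Set.Icc (-1 : ℤ) 1)ᶜ, Γ.gminGrading j :=
      iSup_le fun k => (hSle k).trans (le_biSup Γ.gminGrading (hnk k))
    have h2 := (Γ.gmin_iSupIndep.disjoint_biSup_biSup
      (disjoint_compl_left (a := Set.Icc (-1 : ℤ) 1))).mono_left h1
    exact (h2.mono_right (le_biSup Γ.gminGrading hj)).eq_bot

end LocalLieAlgebra

/-! ### The minimal algebra of an admissible triplet. -/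

namespace FundamentalTriplet

variable {T : FundamentalTriplet.{u}}

/-- If all `[x, y]` vanish then `y(u.x) = B₀([x,y],u) = 0`, so `y` kills the span of `g₀.V`. -/
theorem eq_zero_of_bracket_left (hT : T.Admissible) {y : Module.Dual ℂ T.V}
    (h : ∀ x, T.bracket x y = 0) : y = 0 := by
  have h1 : Submodule.span ℂ {w : T.V | ∃ (u : T.g₀) (x : T.V), w = ⁅u, x⁆} ≤ LinearMap.ker y := by
    rw [Submodule.span_le]
    rintro _ ⟨u, x, rfl⟩
    rw [SetLike.mem_coe, LinearMap.mem_ker, ← B₀_bracket, h, map_zero, LinearMap.zero_apply]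
  rw [hT.span_V, top_le_iff, LinearMap.ker_eq_top] at h1
  exact h1

theorem eq_zero_of_bracket_right (hT : T.Admissible) {x : T.V}
    (h : ∀ y, T.bracket x y = 0) : x = 0 := by
  have h1 : Submodule.span ℂ {w : Module.Dual ℂ T.V | ∃ (u : T.g₀) (y : Module.Dual ℂ T.V),
      w = ⁅u, y⁆} ≤ LinearMap.ker (Module.Dual.eval ℂ T.V x) := by
    rw [Submodule.span_le]
    rintro _ ⟨u, y, rfl⟩
    rw [SetLike.mem_coe, LinearMap.mem_ker, Module.Dual.eval_apply, Module.Dual.lie_apply,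
      ← B₀_bracket, h, map_zero, LinearMap.zero_apply, neg_zero]
  rw [hT.span_dual, top_le_iff, LinearMap.ker_eq_top] at h1
  refine (Module.forall_dual_apply_eq_zero_iff ℂ x).1 fun y => ?_
  exact LinearMap.congr_fun h1 y

theorem eq_zero_of_lie_dual (hT : T.Admissible) {u : T.g₀}
    (h : ∀ y : Module.Dual ℂ T.V, ⁅u, y⁆ = 0) : u = 0 := by
  refine hT.faithful u fun x => (Module.forall_dual_apply_eq_zero_iff ℂ _).1 fun y => ?_
  have := LinearMap.congr_fun (h y) x
  rwa [Module.Dual.lie_apply, LinearMap.zero_apply, neg_eq_zero] at this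

variable (T)

/-- The component `V*` of the minimal graded Lie algebra. -/
def minNeg : Module.Dual ℂ T.V →ₗ[ℂ] T.toLocal.Gmin := T.toLocal.gminNeg

/-- The component `g₀` of the minimal graded Lie algebra. -/
def minZero : T.g₀ →ₗ[ℂ] T.toLocal.Gmin := T.toLocal.gminZero

/-- The component `V` of the minimal graded Lie algebra. -/
def minPos : T.V →ₗ[ℂ] T.toLocal.Gmin := T.toLocal.gminPos

theorem range_minNeg : LinearMap.range T.minNeg = T.toLocal.gminGrading (-1) :=
  T.toLocal.range_gminNeg

theorem range_minZero : LinearMap.range T.minZero = T.toLocal.gminGrading 0 :=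
  T.toLocal.range_gminZero

theorem range_minPos : LinearMap.range T.minPos = T.toLocal.gminGrading 1 :=
  T.toLocal.range_gminPos

theorem toGmin_eq_sum (a : Module.Dual ℂ T.V × T.g₀ × T.V) :
    T.toLocal.toGmin a = T.minNeg a.1 + T.minZero a.2.1 + T.minPos a.2.2 :=
  T.toLocal.toGmin_eq_sum a

theorem minZero_lie_minZero (u v : T.g₀) : ⁅T.minZero u, T.minZero v⁆ = T.minZero ⁅u, v⁆ :=
  T.toLocal.gminZero_lie_gminZero u v

theorem minZero_lie_minPos (u : T.g₀) (x : T.V) : ⁅T.minZero u, T.minPos x⁆ = T.minPos ⁅u, x⁆ :=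
  T.toLocal.gminZero_lie_gminPos u x

theorem minZero_lie_minNeg (u : T.g₀) (y : Module.Dual ℂ T.V) :
    ⁅T.minZero u, T.minNeg y⁆ = T.minNeg ⁅u, y⁆ :=
  T.toLocal.gminZero_lie_gminNeg u y

theorem minPos_lie_minNeg (x : T.V) (y : Module.Dual ℂ T.V) :
    ⁅T.minPos x, T.minNeg y⁆ = T.minZero (T.bracket x y) :=
  T.toLocal.gminPos_lie_gminNeg x y

theorem minPos_lie_minZero (x : T.V) (u : T.g₀) :
    ⁅T.minPos x, T.minZero u⁆ = -T.minPos ⁅u, x⁆ := by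
  rw [← minZero_lie_minPos, lie_skew]

theorem minNeg_lie_minZero (y : Module.Dual ℂ T.V) (u : T.g₀) :
    ⁅T.minNeg y, T.minZero u⁆ = -T.minNeg ⁅u, y⁆ := by
  rw [← minZero_lie_minNeg, lie_skew]

theorem minNeg_lie_minPos (y : Module.Dual ℂ T.V) (x : T.V) :
    ⁅T.minNeg y, T.minPos x⁆ = -T.minZero (T.bracket x y) := by
  rw [← minPos_lie_minNeg, lie_skew]

variable {T}

theorem gmaxZero_injective (hT : T.Admissible) : Function.Injective T.toLocal.gmaxZero :=
  @LocalLieAlgebra.gmaxZero_injective T.toLocal T.V _ _ T.lieRingModule T.lieModule hT.faithful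

theorem minZero_injective (hT : T.Admissible) : Function.Injective T.minZero :=
  T.toLocal.gminZero_injective (gmaxZero_injective hT)

theorem minNeg_injective (hT : T.Admissible) : Function.Injective T.minNeg :=
  T.toLocal.gminNeg_injective (T.toLocal.gmaxNeg_injective (gmaxZero_injective hT)
    fun _ hy => eq_zero_of_bracket_left hT hy)

theorem minPos_injective : Function.Injective T.minPos := by
  -- The induced module over `M = V` detects `V` only when `V` is nonzero; the zero case is trivial.
  rcases subsingleton_or_nontrivial T.V with h | h
  · exact Function.injective_of_subsingleton _
  · exact T.toLocal.gminPos_injective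
      (@LocalLieAlgebra.gmaxPos_injective T.toLocal T.V _ _ T.lieRingModule T.lieModule h)

theorem exists_minNeg {z : T.toLocal.Gmin} (hz : z ∈ T.toLocal.gminGrading (-1)) :
    ∃ y, T.minNeg y = z := by
  rwa [← range_minNeg] at hz

theorem exists_minZero {z : T.toLocal.Gmin} (hz : z ∈ T.toLocal.gminGrading 0) :
    ∃ u, T.minZero u = z := by
  rwa [← range_minZero] at hz

theorem exists_minPos {z : T.toLocal.Gmin} (hz : z ∈ T.toLocal.gminGrading 1) :
    ∃ x, T.minPos x = z := by
  rwa [← range_minPos] at hz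

theorem minNeg_mem (y : Module.Dual ℂ T.V) : T.minNeg y ∈ T.toLocal.gminGrading (-1) :=
  T.range_minNeg ▸ LinearMap.mem_range_self _ y

theorem minZero_mem (u : T.g₀) : T.minZero u ∈ T.toLocal.gminGrading 0 :=
  T.range_minZero ▸ LinearMap.mem_range_self _ u

theorem minPos_mem (x : T.V) : T.minPos x ∈ T.toLocal.gminGrading 1 :=
  T.range_minPos ▸ LinearMap.mem_range_self _ x

theorem gmin_isTransitiveGrading (hT : T.Admissible) :
    IsTransitiveGrading T.toLocal.gminGrading where
  nonneg i hi z hz h := by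
    by_cases hi2 : 2 ≤ i
    · exact T.toLocal.gmin_eq_zero_of_lie_eq_zero (ε := 1) (Or.inl rfl) (by omega) hz h
    · interval_cases i
      · obtain ⟨u, rfl⟩ := exists_minZero hz
        rw [eq_zero_of_lie_dual hT (u := u) fun y => ?_, map_zero]
        rw [← map_eq_zero_iff _ (minNeg_injective hT), ← minZero_lie_minNeg]
        exact h _ (minNeg_mem y)
      · obtain ⟨x, rfl⟩ := exists_minPos hz
        rw [eq_zero_of_bracket_right hT (x := x) fun y => ?_, map_zero]
        rw [← map_eq_zero_iff _ (minZero_injective hT), ← minPos_lie_minNeg]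
        exact h _ (minNeg_mem y)
  nonpos i hi z hz h := by
    by_cases hi2 : i ≤ -2
    · exact T.toLocal.gmin_eq_zero_of_lie_eq_zero (ε := -1) (Or.inr rfl) (by omega) hz
        (by rwa [neg_neg])
    · interval_cases i
      · obtain ⟨y, rfl⟩ := exists_minNeg hz
        rw [eq_zero_of_bracket_left hT (y := y) fun x => ?_, map_zero]
        rw [← map_eq_zero_iff _ (minZero_injective hT), ← neg_eq_zero, ← minNeg_lie_minPos]
        exact h _ (minPos_mem x)
      · obtain ⟨u, rfl⟩ := exists_minZero hz
        rw [hT.faithful u fun x => ?_, map_zero]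
        rw [← map_eq_zero_iff _ minPos_injective, ← minZero_lie_minPos]
        exact h _ (minPos_mem x)

theorem exists_isExtendedForm (hT : T.Admissible) :
    ∃ B : LinearMap.BilinForm ℂ T.toLocal.Gmin, T.IsExtendedForm B := by
  have hgr := T.toLocal.gmin_isGradedLieAlgebra
  obtain ⟨pm, hpm, hpm'⟩ := exists_coordinate hgr.isInternal (minNeg_injective hT) T.range_minNeg
  obtain ⟨p₀, hp₀, hp₀'⟩ := exists_coordinate hgr.isInternal (minZero_injective hT) T.range_minZero
  obtain ⟨pp, hpp, hpp'⟩ := exists_coordinate hgr.isInternal (minPos_injective (T := T))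
    T.range_minPos
  have hpm₀ : ∀ u, pm (T.minZero u) = 0 := fun u => hpm' 0 (by norm_num) _ (minZero_mem u)
  have hpmp : ∀ x, pm (T.minPos x) = 0 := fun x => hpm' 1 (by norm_num) _ (minPos_mem x)
  have hp₀m : ∀ u, p₀ (T.minNeg u) = 0 := fun u => hp₀' (-1) (by norm_num) _ (minNeg_mem u)
  have hp₀p : ∀ x, p₀ (T.minPos x) = 0 := fun x => hp₀' 1 (by norm_num) _ (minPos_mem x)
  have hppm : ∀ u, pp (T.minNeg u) = 0 := fun u => hpp' (-1) (by norm_num) _ (minNeg_mem u)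
  have hpp₀ : ∀ x, pp (T.minZero x) = 0 := fun x => hpp' 0 (by norm_num) _ (minZero_mem x)
  -- The local form extended by zero: the coordinates `pm`, `p₀`, `pp` vanish on all components but
  -- their own.
  let β : LinearMap.BilinForm ℂ T.toLocal.Gmin := LinearMap.mk₂ ℂ
    (fun a b => T.B₀ (p₀ a) (p₀ b) + pm a (pp b) + pm b (pp a))
    (fun a a' b => by simp only [map_add, LinearMap.add_apply]; ring)
    (fun c a b => by simp only [map_smul, LinearMap.smul_apply, smul_eq_mul]; ring)
    (fun a b b' => by simp only [map_add, LinearMap.add_apply]; ring)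
    (fun c a b => by simp only [map_smul, LinearMap.smul_apply, smul_eq_mul]; ring)
  have hβ : ∀ a b, β a b = T.B₀ (p₀ a) (p₀ b) + pm a (pp b) + pm b (pp a) := fun a b => rfl
  have hloc : IsLocalForm T.toLocal.gminGrading β := by
    refine ⟨fun i j hij x hx y hy => ?_, fun x y => ?_, ?_⟩
    · have h1 : T.B₀ (p₀ x) (p₀ y) = 0 := by
        by_cases hi : i = 0
        · rw [hp₀' j (by omega) y hy, map_zero]
        · rw [hp₀' i hi x hx, map_zero, LinearMap.zero_apply]
      have h2 : pm x (pp y) = 0 := by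
        by_cases hi : i = -1
        · rw [hpp' j (by omega) y hy, map_zero]
        · rw [hpm' i hi x hx, LinearMap.zero_apply]
      have h3 : pm y (pp x) = 0 := by
        by_cases hi : i = 1
        · rw [hpm' j (by omega) y hy, LinearMap.zero_apply]
        · rw [hpp' i hi x hx, map_zero]
      rw [hβ, h1, h2, h3, add_zero, add_zero]
    · rw [hβ, hβ, T.form.symm]
      ring
    · intro i k hi1 hi2 hk1 hk2 h1 h2 a ha z hz c hc
      have hB : ∀ x y u, T.B₀ u (T.bracket x y) = y ⁅u, x⁆ := fun x y u => by
        rw [T.form.symm, B₀_bracket]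
      -- Of the nine pairs of degrees, `(-1,-1)` and `(1,1)` have sums out of range. The other seven
      -- unfold to the contragredient action, the definition of the bracket of `V` with `V*`, or
      -- invariance of `B₀`.
      interval_cases i <;> interval_cases k <;> first | (exfalso; omega) | skip
      · obtain ⟨a, rfl⟩ := exists_minNeg ha
        obtain ⟨z, rfl⟩ := exists_minZero hz
        obtain ⟨c, rfl⟩ := exists_minPos hc
        simp [hβ, minNeg_lie_minZero, minZero_lie_minPos, hpm, hpp, hp₀m, hp₀p, hpmp, hppm]
      · obtain ⟨a, rfl⟩ := exists_minNeg ha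
        obtain ⟨z, rfl⟩ := exists_minPos hz
        obtain ⟨c, rfl⟩ := exists_minZero hc
        simp [hβ, minNeg_lie_minPos, minPos_lie_minZero, hpm, hpp, hp₀, hp₀m, hp₀p, hpmp, hppm,
          hpm₀, hpp₀, B₀_bracket]
      · obtain ⟨a, rfl⟩ := exists_minZero ha
        obtain ⟨z, rfl⟩ := exists_minNeg hz
        obtain ⟨c, rfl⟩ := exists_minPos hc
        simp [hβ, minZero_lie_minNeg, minNeg_lie_minPos, hpm, hpp, hp₀, hp₀m, hp₀p, hpmp, hppm,
          hpm₀, hpp₀, hB]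
      · obtain ⟨a, rfl⟩ := exists_minZero ha
        obtain ⟨z, rfl⟩ := exists_minZero hz
        obtain ⟨c, rfl⟩ := exists_minZero hc
        simp [hβ, minZero_lie_minZero, hp₀, hpm₀, hpp₀, T.form.invariant]
      · obtain ⟨a, rfl⟩ := exists_minZero ha
        obtain ⟨z, rfl⟩ := exists_minPos hz
        obtain ⟨c, rfl⟩ := exists_minNeg hc
        simp [hβ, minZero_lie_minPos, minPos_lie_minNeg, hpm, hpp, hp₀, hp₀m, hp₀p, hpmp, hppm,
          hpm₀, hpp₀, hB]
      · obtain ⟨a, rfl⟩ := exists_minPos ha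
        obtain ⟨z, rfl⟩ := exists_minNeg hz
        obtain ⟨c, rfl⟩ := exists_minZero hc
        simp [hβ, minPos_lie_minNeg, minNeg_lie_minZero, hpm, hpp, hp₀, hp₀m, hp₀p, hpmp, hppm,
          hpm₀, hpp₀, B₀_bracket]
      · obtain ⟨a, rfl⟩ := exists_minPos ha
        obtain ⟨z, rfl⟩ := exists_minZero hz
        obtain ⟨c, rfl⟩ := exists_minNeg hc
        simp [hβ, minPos_lie_minZero, minZero_lie_minNeg, hpm, hpp, hp₀m, hp₀p, hpmp, hppm]
  obtain ⟨B, hB, hBgr, hBloc⟩ := hloc.exists_extension hgr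
  refine ⟨B, hB, hBgr, fun a b => ?_⟩
  rw [toGmin_eq_sum, toGmin_eq_sum, map_add B, map_add B,
    hBloc (-1) (by norm_num) (by norm_num) _ (minNeg_mem _),
    hBloc 0 (by norm_num) (by norm_num) _ (minZero_mem _),
    hBloc 1 (by norm_num) (by norm_num) _ (minPos_mem _), ← map_add β, ← map_add β, hβ]
  simp [hpm, hpp, hp₀, hp₀m, hp₀p, hpmp, hppm, hpm₀, hpp₀, localForm]

theorem IsExtendedForm.unique {B B' : LinearMap.BilinForm ℂ T.toLocal.Gmin}
    (hB : T.IsExtendedForm B) (hB' : T.IsExtendedForm B') : B = B' := by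
  have hex : ∀ i : ℤ, -1 ≤ i → i ≤ 1 → ∀ z ∈ T.toLocal.gminGrading i, ∃ a, T.toLocal.toGmin a = z := by
    intro i h1 h2 z hz
    interval_cases i
    · obtain ⟨y, rfl⟩ := exists_minNeg hz
      exact ⟨(y, 0, 0), rfl⟩
    · obtain ⟨y, rfl⟩ := exists_minZero hz
      exact ⟨(0, y, 0), rfl⟩
    · obtain ⟨y, rfl⟩ := exists_minPos hz
      exact ⟨(0, 0, y), rfl⟩
  refine hB.form.eq_of_local T.toLocal.gmin_isGradedLieAlgebra hB'.form hB.gradedForm hB'.gradedForm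
    fun i h1 h2 x hx y hy => ?_
  obtain ⟨a, rfl⟩ := hex i h1 h2 x hx
  obtain ⟨b, rfl⟩ := hex (-i) (by omega) (by omega) y hy
  exact (hB.extends_local a b).trans (hB'.extends_local a b).symm

theorem IsExtendedForm.isLocalModel {B : LinearMap.BilinForm ℂ T.toLocal.Gmin}
    (hB : T.IsExtendedForm B) (hT : T.Admissible) :
    IsLocalModel T T.toLocal.gminGrading B T.minNeg T.minZero T.minPos where
  injective_neg := minNeg_injective hT
  injective_zero := minZero_injective hT
  injective_pos := minPos_injective
  range_neg := T.range_minNeg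
  range_zero := T.range_minZero
  range_pos := T.range_minPos
  zero_zero := T.minZero_lie_minZero
  zero_neg := T.minZero_lie_minNeg
  zero_pos := T.minZero_lie_minPos
  pos_neg := T.minPos_lie_minNeg
  form_zero u v := (hB.extends_local (0, u, 0) (0, v, 0)).trans (by simp [localForm])
  form_pos_neg x y := (hB.extends_local (0, 0, x) (y, 0, 0)).trans (by simp [localForm])

theorem IsExtendedForm.isTransitiveQuadratic {B : LinearMap.BilinForm ℂ T.toLocal.Gmin}
    (hB : T.IsExtendedForm B) (hT : T.Admissible) :
    IsTransitiveQuadratic T.toLocal.gminGrading B where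
  graded := T.toLocal.gmin_isGradedLieAlgebra
  transitive := gmin_isTransitiveGrading hT
  form := hB.form
  gradedForm := hB.gradedForm
  nondegenerate := by
    have m := hB.isLocalModel hT
    refine hB.form.nondegenerate T.toLocal.gmin_isGradedLieAlgebra (gmin_isTransitiveGrading hT)
      hB.gradedForm fun i h1 h2 z hz h => ?_
    interval_cases i
    · obtain ⟨y, rfl⟩ := exists_minNeg hz
      have : y = 0 := LinearMap.ext fun x => by
        rw [LinearMap.zero_apply, ← m.form_pos_neg, hB.form.symm]
        exact h _ (minPos_mem x)
      rw [this, map_zero]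
    · obtain ⟨u, rfl⟩ := exists_minZero hz
      rw [T.nondegenerate.1 u fun v => ?_, map_zero]
      rw [← m.form_zero]
      exact h _ (minZero_mem v)
    · obtain ⟨x, rfl⟩ := exists_minPos hz
      rw [(Module.forall_dual_apply_eq_zero_iff ℂ x).1 fun y => ?_, map_zero]
      rw [← m.form_pos_neg]
      exact h _ (minNeg_mem y)

end FundamentalTriplet

/-! ### Transport along isomorphisms. -/

namespace FundamentalTriplet

variable {S T : FundamentalTriplet.{u}}

theorem eq_of_form {u v : T.g₀} (h : ∀ w, T.B₀ u w = T.B₀ v w) : u = v :=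
  (T.B₀.toDual T.nondegenerate).injective (LinearMap.ext h)

/-- The bracket is defined by the form and the action alone, both preserved; testing against `A w`
for all `w` suffices. -/
theorem bracket_equiv {A : S.g₀ ≃ₗ⁅ℂ⁆ T.g₀} {γ : S.V ≃ₗ[ℂ] T.V}
    (hA : ∀ u v : S.g₀, T.B₀ (A u) (A v) = S.B₀ u v)
    (hγ : ∀ (u : S.g₀) (x : S.V), ⁅A u, γ x⁆ = γ ⁅u, x⁆) (x : S.V) (y : Module.Dual ℂ T.V) :
    T.bracket (γ x) y = A (S.bracket x (y ∘ₗ γ.toLinearMap)) := by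
  refine eq_of_form fun w => ?_
  obtain ⟨w, rfl⟩ := A.surjective w
  change T.B₀ _ (A w) = T.B₀ _ (A w)
  rw [B₀_bracket, hA, B₀_bracket, hγ]
  rfl

end FundamentalTriplet

namespace IsLocalModel

variable {L L' : Type u} [LieRing L] [LieAlgebra ℂ L] [LieRing L'] [LieAlgebra ℂ L']
  {S T : FundamentalTriplet.{u}} {gr : ℤ → Submodule ℂ L} {gr' : ℤ → Submodule ℂ L'}
  {B : LinearMap.BilinForm ℂ L} {B' : LinearMap.BilinForm ℂ L'}
  {fm : Module.Dual ℂ T.V →ₗ[ℂ] L} {f₀ : T.g₀ →ₗ[ℂ] L} {fp : T.V →ₗ[ℂ] L}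
  {fm' : Module.Dual ℂ S.V →ₗ[ℂ] L'} {f₀' : S.g₀ →ₗ[ℂ] L'} {fp' : S.V →ₗ[ℂ] L'}

/-- A local model for a triplet is one for every isomorphic triplet. -/
theorem of_iso (m : IsLocalModel T gr B fm f₀ fp) {A : S.g₀ ≃ₗ⁅ℂ⁆ T.g₀} {γ : S.V ≃ₗ[ℂ] T.V}
    (hA : ∀ u v : S.g₀, T.B₀ (A u) (A v) = S.B₀ u v)
    (hγ : ∀ (u : S.g₀) (x : S.V), ⁅A u, γ x⁆ = γ ⁅u, x⁆) :
    IsLocalModel S gr B (fm ∘ₗ γ.symm.dualMap.toLinearMap)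
      (f₀ ∘ₗ A.toLinearEquiv.toLinearMap) (fp ∘ₗ γ.toLinearMap) where
  injective_neg := m.injective_neg.comp γ.symm.dualMap.injective
  injective_zero := m.injective_zero.comp A.injective
  injective_pos := m.injective_pos.comp γ.injective
  range_neg := by
    rw [LinearMap.range_comp, LinearEquiv.range, Submodule.map_top, m.range_neg]
  range_zero := by
    rw [LinearMap.range_comp, LinearEquiv.range, Submodule.map_top, m.range_zero]
  range_pos := by
    rw [LinearMap.range_comp, LinearEquiv.range, Submodule.map_top, m.range_pos]
  zero_zero u v := (m.zero_zero (A u) (A v)).trans (congrArg f₀ (LieHom.map_lie A.toLieHom u v).symm)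
  zero_neg u y := by
    refine (m.zero_neg (A u) (γ.symm.dualMap y)).trans (congrArg fm (LinearMap.ext fun x => ?_))
    obtain ⟨x, rfl⟩ := γ.surjective x
    rw [Module.Dual.lie_apply, hγ, LinearEquiv.dualMap_apply]
    simp [Module.Dual.lie_apply]
  zero_pos u x := (m.zero_pos (A u) (γ x)).trans (congrArg fp (hγ u x))
  pos_neg x y := by
    refine (m.pos_neg (γ x) (γ.symm.dualMap y)).trans (congrArg f₀ ?_)
    have hy : γ.symm.dualMap y ∘ₗ γ.toLinearMap = y := LinearMap.ext fun x => by simp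
    rw [FundamentalTriplet.bracket_equiv hA hγ, hy]
    rfl
  form_zero u v := (m.form_zero (A u) (A v)).trans (hA u v)
  form_pos_neg x y := (m.form_pos_neg (γ x) (γ.symm.dualMap y)).trans (by simp)

/-- Restricts an isomorphism of algebras to a component and reads it through the parametrisations;
used in degrees `0` and `1`. -/
theorem exists_linearEquiv {E E' F F' : Type*} [AddCommGroup E] [Module ℂ E] [AddCommGroup E']
    [Module ℂ E'] [AddCommGroup F] [Module ℂ F] [AddCommGroup F'] [Module ℂ F'] {f : E →ₗ[ℂ] F}
    {f' : E' →ₗ[ℂ] F'} (hf : Function.Injective f) (hf' : Function.Injective f') (Ψ : F ≃ₗ[ℂ] F')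
    (h : ∀ z, z ∈ LinearMap.range f ↔ Ψ z ∈ LinearMap.range f') :
    ∃ e : E ≃ₗ[ℂ] E', ∀ x, f' (e x) = Ψ (f x) := by
  have hex : ∀ x, ∃ y, f' y = Ψ (f x) := fun x => (h (f x)).1 ⟨x, rfl⟩
  choose e he using hex
  let e' : E →ₗ[ℂ] E' :=
    { toFun := e
      map_add' := fun a b => hf' (by rw [map_add, he, he, he, map_add, map_add])
      map_smul' := fun c a => hf' (by
        rw [RingHom.id_apply, map_smul, he, he, map_smul, map_smul]) }
  refine ⟨LinearEquiv.ofBijective e' ⟨fun a b hab => ?_, fun y => ?_⟩, he⟩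
  · have h1 : f' (e a) = f' (e b) := congrArg f' hab
    rw [he, he] at h1
    exact hf (Ψ.injective h1)
  · obtain ⟨z, hz⟩ := Ψ.surjective (f' y)
    obtain ⟨x, rfl⟩ := (h z).2 (hz ▸ ⟨y, rfl⟩)
    exact ⟨x, hf' ((he x).trans hz)⟩

/-- Isomorphic quadratic graded Lie algebras have isomorphic local models. -/
theorem iso_triplet (m : IsLocalModel T gr B fm f₀ fp) (m' : IsLocalModel S gr' B' fm' f₀' fp')
    (Ψ : L ≃ₗ⁅ℂ⁆ L') (hgr : ∀ n x, x ∈ gr n ↔ Ψ x ∈ gr' n)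
    (hB : ∀ x y, B' (Ψ x) (Ψ y) = B x y) : T.Iso S := by
  obtain ⟨A, hA⟩ := exists_linearEquiv m.injective_zero m'.injective_zero Ψ.toLinearEquiv
    (by rw [m.range_zero, m'.range_zero]; exact hgr 0)
  obtain ⟨γ, hγ⟩ := exists_linearEquiv m.injective_pos m'.injective_pos Ψ.toLinearEquiv
    (by rw [m.range_pos, m'.range_pos]; exact hgr 1)
  replace hA : ∀ u, f₀' (A u) = Ψ (f₀ u) := hA
  replace hγ : ∀ x, fp' (γ x) = Ψ (fp x) := hγ
  refine ⟨{ A with map_lie' := fun {u v} => m'.injective_zero ?_ }, γ, fun u v => ?_, fun u x => ?_⟩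
  · change f₀' (A ⁅u, v⁆) = f₀' ⁅A u, A v⁆
    rw [← m'.zero_zero, hA, hA, hA, ← m.zero_zero, LieEquiv.map_lie]
  · change S.B₀ (A u) (A v) = _
    rw [← m'.form_zero, hA, hA, hB, m.form_zero]
  · refine m'.injective_pos ?_
    change fp' ⁅A u, γ x⁆ = _
    rw [← m'.zero_pos, hA, hγ, hγ, ← m.zero_pos, LieEquiv.map_lie]

end IsLocalModel

/-! ### The triplet of a transitive quadratic algebra. -/

namespace IsTransitiveQuadratic

variable {L : Type u} [LieRing L] [LieAlgebra ℂ L] {gr : ℤ → Submodule ℂ L}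
  {B : LinearMap.BilinForm ℂ L}

/-- The component of degree `0` of a graded Lie algebra. -/
def zeroPart (h : IsTransitiveQuadratic gr B) : LieSubalgebra ℂ L :=
  { gr 0 with lie_mem' := fun {x y} hx hy => by simpa using h.graded.lie_mem 0 0 x hx y hy }

/-- The component of degree `1` of a graded Lie algebra, as a module over that of degree `0`. -/
def posPart (h : IsTransitiveQuadratic gr B) : LieSubmodule ℂ h.zeroPart L :=
  { gr 1 with lie_mem := fun {u x} hx => by simpa using h.graded.lie_mem 0 1 u u.2 x hx }

/-- The fundamental triplet of a transitive quadratic graded Lie algebra. -/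
def triplet (h : IsTransitiveQuadratic gr B) : FundamentalTriplet.{u} :=
  haveI : FiniteDimensional ℂ h.zeroPart := h.graded.finiteDimensional 0
  haveI : FiniteDimensional ℂ h.posPart := h.graded.finiteDimensional 1
  { g₀ := h.zeroPart
    V := h.posPart
    B₀ := B.compl₁₂ h.zeroPart.toSubmodule.subtype h.zeroPart.toSubmodule.subtype
    form := ⟨fun x y => h.form.symm x y, fun x y z => h.form.invariant x y z⟩
    nondegenerate := by
      have key : ∀ u : h.zeroPart, (∀ v : h.zeroPart, B u v = 0) → u = 0 := fun u hu =>
        Subtype.ext (h.eq_zero_of_forall u.2 fun y hy => hu ⟨y, (by simpa using hy : y ∈ gr 0)⟩)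
      exact ⟨key, fun u hu => key u fun v => (h.form.symm u v).trans (hu v)⟩ }

/-- The inclusion of the component of degree `0`. -/
def tripletZero (h : IsTransitiveQuadratic gr B) : h.triplet.g₀ →ₗ[ℂ] L :=
  h.zeroPart.toSubmodule.subtype

/-- The inclusion of the component of degree `1`. -/
def tripletPos (h : IsTransitiveQuadratic gr B) : h.triplet.V →ₗ[ℂ] L :=
  h.posPart.toSubmodule.subtype

variable (h : IsTransitiveQuadratic gr B)

theorem tripletZero_mem (u : h.triplet.g₀) : h.tripletZero u ∈ gr 0 := Subtype.property u

theorem tripletPos_mem (x : h.triplet.V) : h.tripletPos x ∈ gr 1 := Subtype.property x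

theorem tripletZero_injective : Function.Injective h.tripletZero := Subtype.val_injective

theorem tripletPos_injective : Function.Injective h.tripletPos := Subtype.val_injective

theorem exists_tripletZero {z : L} (hz : z ∈ gr 0) : ∃ u, h.tripletZero u = z := ⟨⟨z, hz⟩, rfl⟩

theorem exists_tripletPos {z : L} (hz : z ∈ gr 1) : ∃ x, h.tripletPos x = z := ⟨⟨z, hz⟩, rfl⟩

theorem tripletPos_lie (u : h.triplet.g₀) (x : h.triplet.V) :
    h.tripletPos ⁅u, x⁆ = ⁅h.tripletZero u, h.tripletPos x⁆ := rfl

theorem triplet_form (u v : h.triplet.g₀) :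
    h.triplet.B₀ u v = B (h.tripletZero u) (h.tripletZero v) := rfl

theorem exists_tripletNeg : ∃ fm : Module.Dual ℂ h.triplet.V →ₗ[ℂ] L, Function.Injective fm ∧
    LinearMap.range fm = gr (-1) ∧ ∀ x y, B (h.tripletPos x) (fm y) = y x := by
  have := h.graded.finiteDimensional (-1)
  let P : gr (-1) →ₗ[ℂ] Module.Dual ℂ h.triplet.V :=
    (LinearMap.flip B).compl₁₂ (gr (-1)).subtype h.tripletPos
  have hP : ∀ z x, P z x = B (h.tripletPos x) z := fun _ _ => rfl
  have hinj : Function.Injective P := by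
    refine (injective_iff_map_eq_zero _).2 fun z hz => Subtype.ext ?_
    refine h.eq_zero_of_forall z.2 fun w hw => ?_
    obtain ⟨x, rfl⟩ := h.exists_tripletPos (by simpa using hw)
    rw [h.form.symm, ← hP, hz, LinearMap.zero_apply]
  have hinj' : Function.Injective P.flip := by
    refine (injective_iff_map_eq_zero _).2 fun x hx => h.tripletPos_injective ?_
    rw [map_zero]
    refine h.eq_zero_of_forall (h.tripletPos_mem x) fun w hw => ?_
    exact LinearMap.congr_fun hx ⟨w, hw⟩
  -- The pairing of degrees `-1` and `1` is injective on both sides, which gives the two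
  -- inequalities of dimensions.
  have hdim : Module.finrank ℂ (gr (-1)) = Module.finrank ℂ (Module.Dual ℂ h.triplet.V) := by
    refine le_antisymm (LinearMap.finrank_le_finrank_of_injective hinj) ?_
    rw [Subspace.dual_finrank_eq, ← Subspace.dual_finrank_eq (K := ℂ) (V := gr (-1))]
    exact LinearMap.finrank_le_finrank_of_injective hinj'
  let e := LinearEquiv.ofInjectiveOfFinrankEq P hinj hdim
  have he : ∀ z, e z = P z := fun _ => rfl
  refine ⟨(gr (-1)).subtype ∘ₗ e.symm.toLinearMap,
    Subtype.val_injective.comp e.symm.injective, ?_, fun x y => ?_⟩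
  · rw [LinearMap.range_comp, LinearEquiv.range, Submodule.map_top, Submodule.range_subtype]
  · change B _ ((e.symm y : gr (-1)) : L) = _
    rw [← hP, ← he, LinearEquiv.apply_symm_apply]

/-- Only the brackets involving degree `-1` need an argument, since that component was replaced by
`V*`. Each is checked by pairing with the opposite degree, where invariance of the form gives the
formula. -/
theorem exists_isLocalModel : ∃ fm, IsLocalModel h.triplet gr B fm h.tripletZero h.tripletPos := by
  obtain ⟨fm, hinj, hrange, hfm⟩ := h.exists_tripletNeg
  have hmem : ∀ y, fm y ∈ gr (-1) := fun y => hrange ▸ LinearMap.mem_range_self fm y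
  have hneg : ∀ z ∈ gr (-1), ∀ w ∈ gr (-1),
      (∀ x, B (h.tripletPos x) z = B (h.tripletPos x) w) → z = w := by
    intro z hz w hw hzw
    refine sub_eq_zero.1 (h.eq_zero_of_forall (sub_mem hz hw) fun c hc => ?_)
    obtain ⟨x, rfl⟩ := h.exists_tripletPos (by simpa using hc)
    rw [h.form.symm, map_sub, hzw, sub_self]
  have hzero : ∀ z ∈ gr 0, ∀ w ∈ gr 0,
      (∀ u, B z (h.tripletZero u) = B w (h.tripletZero u)) → z = w := by
    intro z hz w hw hzw
    refine sub_eq_zero.1 (h.eq_zero_of_forall (sub_mem hz hw) fun c hc => ?_)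
    obtain ⟨u, rfl⟩ := h.exists_tripletZero (by simpa using hc)
    rw [map_sub, LinearMap.sub_apply, hzw, sub_self]
  refine ⟨fm,
  { injective_neg := hinj
    injective_zero := h.tripletZero_injective
    injective_pos := h.tripletPos_injective
    range_neg := hrange
    range_zero := Submodule.range_subtype _
    range_pos := Submodule.range_subtype _
    zero_zero := fun u v => rfl
    zero_neg := fun u y => ?_
    zero_pos := fun u x => rfl
    pos_neg := fun x y => ?_
    form_zero := fun u v => rfl
    form_pos_neg := hfm }⟩
  · refine hneg _ ?_ _ (hmem _) fun x => ?_
    · simpa using h.graded.lie_mem 0 (-1) _ (h.tripletZero_mem u) _ (hmem y)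
    · rw [hfm, Module.Dual.lie_apply, ← hfm, tripletPos_lie, ← h.form.invariant, ← lie_skew,
        map_neg, LinearMap.neg_apply]
  · refine hzero _ ?_ _ (h.tripletZero_mem _) fun u => ?_
    · simpa using h.graded.lie_mem 1 (-1) _ (h.tripletPos_mem x) _ (hmem y)
    · rw [← triplet_form, FundamentalTriplet.B₀_bracket, ← hfm, tripletPos_lie, h.form.symm,
        ← h.form.invariant]

theorem triplet_admissible : h.triplet.Admissible := by
  obtain ⟨fm, m⟩ := h.exists_isLocalModel
  have hbr : ∀ (x : h.triplet.V) (y : Module.Dual ℂ h.triplet.V),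
      (∀ u : h.triplet.g₀, y ⁅u, x⁆ = 0) → ⁅h.tripletPos x, fm y⁆ = 0 := by
    intro x y hxy
    rw [m.pos_neg, FundamentalTriplet.eq_of_form (u := h.triplet.bracket x y) (v := 0), map_zero]
    intro w
    rw [FundamentalTriplet.B₀_bracket, hxy, map_zero, LinearMap.zero_apply]
  refine ⟨fun u hu => ?_, ?_, ?_⟩
  · refine h.tripletZero_injective ?_
    rw [map_zero]
    refine h.transitive.nonpos 0 le_rfl _ (h.tripletZero_mem u) fun z hz => ?_
    obtain ⟨x, rfl⟩ := h.exists_tripletPos hz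
    rw [← tripletPos_lie, hu, map_zero]
  · by_contra hne
    -- A nonzero functional vanishing on `g₀.V` would be an element of degree `-1` commuting with
    -- degree `1`, against transitivity.
    obtain ⟨y, hy, hle⟩ := Submodule.exists_le_ker_of_lt_top _ (lt_top_iff_ne_top.2 hne)
    refine hy (m.injective_neg ?_)
    rw [map_zero]
    refine h.transitive.nonpos (-1) (by norm_num) _ (m.neg_mem y) fun z hz => ?_
    obtain ⟨x, rfl⟩ := h.exists_tripletPos hz
    rw [← lie_skew, hbr, neg_zero]
    exact fun u => hle (Submodule.subset_span ⟨u, x, rfl⟩)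
  · by_contra hne
    obtain ⟨f, hf, hle⟩ := Submodule.exists_le_ker_of_lt_top _ (lt_top_iff_ne_top.2 hne)
    -- By finite dimension a functional on `V*` is evaluation at some `x`, which commutes with
    -- degree `-1` and so vanishes.
    obtain ⟨x, rfl⟩ := (Module.evalEquiv ℂ h.triplet.V).surjective f
    refine hf ?_
    suffices hx : x = 0 by rw [hx, map_zero]
    refine h.tripletPos_injective ?_
    rw [map_zero]
    refine h.transitive.nonneg 1 (by norm_num) _ (h.tripletPos_mem x) fun z hz => ?_
    obtain ⟨y, rfl⟩ := m.exists_neg hz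
    refine hbr x y fun u => ?_
    have h1 := hle (Submodule.subset_span ⟨u, y, rfl⟩)
    rw [LinearMap.mem_ker, Module.evalEquiv_apply, Module.Dual.eval_apply, Module.Dual.lie_apply, neg_eq_zero] at h1
    exact h1

end IsTransitiveQuadratic

/-! ### The bijection on isomorphism classes. -/

namespace FundamentalTriplet

/-- The invariant form on the minimal graded Lie algebra of an admissible triplet. -/
def extendedForm (T : FundamentalTriplet.{u}) (hT : T.Admissible) :
    LinearMap.BilinForm ℂ T.toLocal.Gmin := (exists_isExtendedForm hT).choose

theorem extendedForm_spec (T : FundamentalTriplet.{u}) (hT : T.Admissible) :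
    T.IsExtendedForm (T.extendedForm hT) := (exists_isExtendedForm hT).choose_spec

/-- The transitive quadratic graded Lie algebra of an admissible triplet. -/
def minimalGLA (T : FundamentalTriplet.{u}) (hT : T.Admissible) : TransitiveQuadraticGLA.{u} where
  carrier := T.toLocal.Gmin
  gr := T.toLocal.gminGrading
  B := T.extendedForm hT
  isTransitiveQuadratic := (T.extendedForm_spec hT).isTransitiveQuadratic hT

/-- After transport along the isomorphism, both algebras are models of the same triplet `S`, so
`exists_iso` applies. -/
theorem minimalGLA_iso {S T : FundamentalTriplet.{u}} (hS : S.Admissible) (hT : T.Admissible)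
    (h : S.Iso T) : (S.minimalGLA hS).Iso (T.minimalGLA hT) := by
  obtain ⟨A, γ, hA, hγ⟩ := h
  exact ((S.extendedForm_spec hS).isLocalModel hS).exists_iso
    (((T.extendedForm_spec hT).isLocalModel hT).of_iso hA hγ)
    (S.minimalGLA hS).isTransitiveQuadratic (T.minimalGLA hT).isTransitiveQuadratic

theorem iso_of_minimalGLA_iso {S T : FundamentalTriplet.{u}} (hS : S.Admissible)
    (hT : T.Admissible) (h : (S.minimalGLA hS).Iso (T.minimalGLA hT)) : S.Iso T := by
  obtain ⟨Ψ, h1, h2⟩ := h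
  exact ((S.extendedForm_spec hS).isLocalModel hS).iso_triplet
    ((T.extendedForm_spec hT).isLocalModel hT) Ψ h1 h2

/-- Surjectivity on classes: `G` and the minimal algebra of its triplet share a local model and are
both transitive. -/
theorem minimalGLA_triplet_iso (G : TransitiveQuadraticGLA.{u}) :
    (G.isTransitiveQuadratic.triplet.minimalGLA
      G.isTransitiveQuadratic.triplet_admissible).Iso G := by
  obtain ⟨fm, m⟩ := G.isTransitiveQuadratic.exists_isLocalModel
  have hT := G.isTransitiveQuadratic.triplet_admissible
  exact ((extendedForm_spec _ hT).isLocalModel hT).exists_iso m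
    (minimalGLA _ hT).isTransitiveQuadratic G.isTransitiveQuadratic

/-- The map induced by the minimal graded Lie algebra on isomorphism classes. -/
def minimalClass : Classes.{u} → TransitiveQuadraticGLA.Classes.{u} :=
  Quotient.lift (fun T => TransitiveQuadraticGLA.toClass (T.1.minimalGLA T.2))
    fun S T h => Quotient.sound (minimalGLA_iso S.2 T.2 h)

theorem minimalClass_bijective : Function.Bijective minimalClass.{u} := by
  constructor
  · rintro ⟨S⟩ ⟨T⟩ h
    exact Quotient.sound (iso_of_minimalGLA_iso S.2 T.2 (Quotient.exact h))
  · rintro ⟨G⟩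
    exact ⟨toClass _ G.isTransitiveQuadratic.triplet_admissible,
      Quotient.sound (minimalGLA_triplet_iso G)⟩

end FundamentalTriplet

end

theorem theorem3 :
    ∃ τ : FundamentalTriplet.Classes.{u} → TransitiveQuadraticGLA.Classes.{u},
      Function.Bijective τ ∧
      ∀ (T : FundamentalTriplet.{u}) (hT : T.Admissible),
        ∃ B : LinearMap.BilinForm ℂ T.toLocal.Gmin,
          T.IsExtendedForm B ∧
          (∀ B' : LinearMap.BilinForm ℂ T.toLocal.Gmin, T.IsExtendedForm B' → B' = B) ∧
          ∃ hB : IsTransitiveQuadratic T.toLocal.gminGrading B,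
            τ (T.toClass hT) = TransitiveQuadraticGLA.toClass
              { carrier := T.toLocal.Gmin
                gr := T.toLocal.gminGrading
                B := B
                isTransitiveQuadratic := hB } :=
  ⟨FundamentalTriplet.minimalClass, FundamentalTriplet.minimalClass_bijective, fun T hT =>
    ⟨T.extendedForm hT, T.extendedForm_spec hT,
      fun _ hB' => hB'.unique (T.extendedForm_spec hT),
      -- `Quotient.lift` computes on representatives, so the value of `τ` holds by definition.
      (T.extendedForm_spec hT).isTransitiveQuadratic hT, rfl⟩⟩
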